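/- **Definitions.** A net $N=(\mathcal P,\mathcal T,\mathit{pre},\mathit{post},\mathit{In})$ has disjoint sets of places $\mathcal P$ and transitions $\mathcal T$, assigns to each transition $t$ a finite nonempty set $\mathit{pre}(t)\subseteq\mathcal P$ and a finite set $\mathit{post}(t)\subseteq\mathcal P$, and has an initial marking $\mathit{In}\subseteq\mathcal P$; markings are multisets of places, $t$ is enabled at $M$ if $\mathit{pre}(t)\subseteq M$, and firing it gives $M-\mathit{pre}(t)+\mathit{post}(t)$. A net is safe if no reachable marking puts two tokens on one place. On nodes (places and transitions), $<$ is the transitive closure of the flow relation ($p\to t$ if $p\in\mathit{pre}(t)$, $t\to p$ if $p\in\mathit{post}(t)$) and $\le$ its reflexive closure; $x\mathrel\#y$ (conflict) if there are transitions $s\ne s'$ with $\mathit{pre}(s)\cap\mathit{pre}(s')\neq\emptyset$, $s\le x$, $s'\le y$; $x\parallel y$ (concurrent) if neither $x\le y$, nor $y\le x$, nor $x\mathrel\# y$. An occurrence net is an acyclic net in which every node has finitely many predecessors, every place lies in at most one postset, no transition is in conflict with itself, and $\mathit{In}$ is the set of places lying in no postset. A branching process of a net $N_0$ is an occurrence net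 $N$ with a map $\pi$ from its places and transitions to those of $N_0$ that restricts to bijections $\mathit{pre}(t)\to\mathit{pre}_0(\pi(t))$, $\mathit{post}(t)\to\mathit{post}_0(\pi(t))$ for every transition $t$ and $\mathit{In}\to\mathit{In}_0$, such that $\mathit{pre}(t)=\mathit{pre}(t')$ and $\pi(t)=\pi(t')$ imply $t=t'$. A Petri game $G$ is a finite safe net $N_0$ whose places are partitioned into system and environment places, with a set $\mathcal B$ of bad markings (sets of places). A winning strategy of $G$ is a branching process $\sigma=(N,\pi)$ of $N_0$ with: 1. (justified refusal) if $C$ is a set of pairwise concurrent places, $t\in\mathcal T_0$, $\pi(C)=\mathit{pre}_0(t)$, and no transition $t'$ of $N$ has $\pi(t')=t$ and $\mathit{pre}(t')=C$, then some $p\in C$ with $\pi(p)$ a system place has no transition labelled $t$ among those consuming $p$; 2. (safety) $\pi(M)\notin\mathcal B$ for every reachable marking $M$ of $N$; 3. (determinism) if $\pi(p)$ is a system place and $M$ is a reachable marking with $p\in M$, at most one transition consuming $p$ is enabled at $M$; 4. (deadlock avoidance) if $M$ is a reachable marking of $N$ and some transition of $N_0$ is enabled at $\pi(M)$, then some transition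 of $N$ is enabled at $M$. A cut of a branching process $B$ is a reachable marking of $B$. The future $\mathit{Fut}(B,C)$ of a cut $C$ consists of all nodes $x$ such that $p\le x$ or $p\parallel x$ for every $p\in C$; its initial marking is $C$. For cuts $C_1,C_2$ with $\pi(C_1)=\pi(C_2)$, the cut and glued process $B_{C_1\to C_2}$ is obtained from $B$ by removing all nodes of $\mathit{Fut}(B,C_2)$ except the places of $C_2$, and adding a label-preserving isomorphic copy of $\mathit{Fut}(B,C_1)$ whose initial marking is $C_2$ and whose other nodes are new. Here a remaining transition is consistently renamed: if its preset contained a removed place $p$ all of whose predecessors in $C_2$ lie in $C_1$ (so that $p$ belongs to both futures), then $p$ is replaced there by its copy; the same applies to postsets and to the initial marking. The cut $C_2$ of a winning strategy $\sigma$ is *imitable* by the cut $C_1$ if $\sigma_{C_1\to C_2}$ is a winning strategy of $G$. For a transition $t$ of $\sigma$ let the last known cut $\mathit{lkc}(t)$ be the set of places $p$ such that $p\not< t$ and every transition producing $p$ is $\le t$, and let the last known marking be $\mathit{lkm}(t)=\pi(\mathit{lkc}(t))$. **Lemma (partial repetition cuts are imitable).** Let $\sigma$ be a winning strategy of a Petri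 game $G$ and let $t_1,t_2$ be transitions of $\sigma$ with $$\mathit{lkm}(t_1)=\mathit{lkm}(t_2)\quad\text{and}\quad \mathit{lkc}(t_1)\setminus\mathit{post}(t_1)=\mathit{lkc}(t_2)\setminus\mathit{post}(t_2).$$ Then $\mathit{lkc}(t_1)$ and $\mathit{lkc}(t_2)$ are cuts, $\mathit{lkc}(t_2)$ is imitable by $\mathit{lkc}(t_1)$, and $\mathit{lkc}(t_1)$ is imitable by $\mathit{lkc}(t_2)$. -/

import Mathlib

universe u v u₀ v₀

/-- The data of a net with set of places `P` and set of transitions `T`: presets and postsets of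
transitions and the initial marking. The laws are in `Net.IsPetriNet`. -/
structure Net (P : Type u) (T : Type v) where
  pre : T → Set P
  post : T → Set P
  init : Set P

namespace Net

variable {P : Type u} {T : Type v}

/-- A Petri net: presets are finite and nonempty, postsets are finite. -/
structure IsPetriNet (N : Net P T) : Prop where
  pre_finite : ∀ t, (N.pre t).Finite
  pre_nonempty : ∀ t, (N.pre t).Nonempty
  post_finite : ∀ t, (N.post t).Finite

/-! Markings are multisets of places, written as multiplicity functions `P → ℕ`. -/

/-- `t` is enabled at the marking `M`. -/
def Enabled (N : Net P T) (M : P → ℕ) (t : T) : Prop := ∀ p ∈ N.pre t, 1 ≤ M p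

/-- The marking after firing `t` at `M`, namely `M - pre t + post t`. -/
noncomputable def fire (N : Net P T) (M : P → ℕ) (t : T) : P → ℕ :=
  M - (N.pre t).indicator 1 + (N.post t).indicator 1

/-- The reachable markings. -/
inductive Reachable (N : Net P T) : (P → ℕ) → Prop
  | init : Reachable N (N.init.indicator 1)
  | step (M : P → ℕ) (t : T) : Reachable N M → N.Enabled M t → Reachable N (N.fire M t)

/-- Safe nets: no reachable marking puts two tokens on one place. -/
def IsSafe (N : Net P T) : Prop := ∀ M, N.Reachable M → ∀ p, M p ≤ 1

/-- The flow relation on nodes (places are `Sum.inl p`, transitions are `Sum.inr t`). -/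
def Flow (N : Net P T) : P ⊕ T → P ⊕ T → Prop
  | Sum.inl p, Sum.inr t => p ∈ N.pre t
  | Sum.inr t, Sum.inl p => p ∈ N.post t
  | _, _ => False

/-- `x < y`: there is a nonempty path from `x` to `y`. -/
def Lt (N : Net P T) (x y : P ⊕ T) : Prop := Relation.TransGen N.Flow x y

/-- `x ≤ y`: `x` is a causal predecessor of `y`. -/
def Le (N : Net P T) (x y : P ⊕ T) : Prop := Relation.ReflTransGen N.Flow x y

/-- `x # y`: two distinct transitions that share a place of their presets precede `x` and `y`. -/
def Conflict (N : Net P T) (x y : P ⊕ T) : Prop :=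
  ∃ t₁ t₂ : T, t₁ ≠ t₂ ∧ (N.pre t₁ ∩ N.pre t₂).Nonempty ∧
    N.Le (Sum.inr t₁) x ∧ N.Le (Sum.inr t₂) y

/-- `x || y`: neither causally related nor in conflict. -/
def Concurrent (N : Net P T) (x y : P ⊕ T) : Prop :=
  ¬ N.Le x y ∧ ¬ N.Le y x ∧ ¬ N.Conflict x y

/-- Occurrence nets. -/
structure IsOccurrenceNet (N : Net P T) : Prop extends N.IsPetriNet where
  acyclic : ∀ x, ¬ N.Lt x x
  finitely_preceded : ∀ x, {y | N.Le y x}.Finite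
  pre_place_subsingleton : ∀ p, {t | p ∈ N.post t}.Subsingleton
  no_self_conflict : ∀ t, ¬ N.Conflict (Sum.inr t) (Sum.inr t)
  init_eq : N.init = {p | {t | p ∈ N.post t} = ∅}

/-- Cuts: the reachable markings, as sets of places. -/
def IsCut (N : Net P T) (C : Set P) : Prop := ∃ M, N.Reachable M ∧ C = {p | M p ≠ 0}

/-- The nodes of the future of `C`. -/
def InFuture (N : Net P T) (C : Set P) (x : P ⊕ T) : Prop :=
  ∀ p ∈ C, N.Le (Sum.inl p) x ∨ N.Concurrent (Sum.inl p) x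

/-- The places of the future of `C`. Its initial marking is `C`. -/
def futurePlaces (N : Net P T) (C : Set P) : Set P := {p | N.InFuture C (Sum.inl p)}

/-- The transitions of the future of `C`. -/
def futureTransitions (N : Net P T) (C : Set P) : Set T := {t | N.InFuture C (Sum.inr t)}

/-- The last known cut of a transition. -/
def lkc (N : Net P T) (t : T) : Set P :=
  {p | ¬ N.Lt (Sum.inl p) (Sum.inr t) ∧ ∀ t', p ∈ N.post t' → N.Le (Sum.inr t') (Sum.inr t)}

end Net

/-- A net together with a map of its places and transitions to those of an underlying net. -/
structure LabelledNet (P : Type u) (T : Type v) (P₀ : Type u₀) (T₀ : Type v₀) extends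
    Net P T where
  πP : P → P₀
  πT : T → T₀

/-- A Petri game on a finite safe Petri net (the finiteness is that of `P₀` and `T₀`). The
environment places are those which are not system places. -/
structure PetriGame (P₀ : Type u₀) (T₀ : Type v₀) extends Net P₀ T₀ where
  isPetriNet : toNet.IsPetriNet
  isSafe : toNet.IsSafe
  /-- the system places -/
  sys : Set P₀
  /-- the bad markings -/
  bad : Set (Set P₀)

namespace LabelledNet

variable {P : Type u} {T : Type v} {P₀ : Type u₀} {T₀ : Type v₀}

/-- The labelling is a homomorphism of Petri nets to `N₀`. -/
structure IsHom (B : LabelledNet P T P₀ T₀) (N₀ : Net P₀ T₀) : Prop where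
  pre_bijOn : ∀ t, Set.BijOn B.πP (B.pre t) (N₀.pre (B.πT t))
  post_bijOn : ∀ t, Set.BijOn B.πP (B.post t) (N₀.post (B.πT t))
  init_bijOn : Set.BijOn B.πP B.init N₀.init

/-- `B` is a branching process of `N₀`. -/
structure IsBranchingProc (B : LabelledNet P T P₀ T₀) (N₀ : Net P₀ T₀) : Prop where
  isOccurrenceNet : B.toNet.IsOccurrenceNet
  isHom : B.IsHom N₀
  eq_of_pre_eq : ∀ t₁ t₂, B.pre t₁ = B.pre t₂ → B.πT t₁ = B.πT t₂ → t₁ = t₂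

/-- The set of places of the underlying net that are marked when `B` is in the marking `M`. -/
def image (B : LabelledNet P T P₀ T₀) (M : P → ℕ) : Set P₀ := B.πP '' {p | M p ≠ 0}

/-- `B` is a winning strategy of the game `G`. -/
structure IsWinning (B : LabelledNet P T P₀ T₀) (G : PetriGame P₀ T₀) : Prop where
  isBranchingProc : B.IsBranchingProc G.toNet
  justified_refusal : ∀ (C : Set P) (t : T₀),
    C.Pairwise (fun p q => B.Concurrent (Sum.inl p) (Sum.inl q)) →
    B.πP '' C = G.pre t →
    (¬ ∃ t', B.πT t' = t ∧ B.pre t' = C) →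
    ∃ p ∈ C, B.πP p ∈ G.sys ∧ t ∉ B.πT '' {t' | p ∈ B.pre t'}
  safety : ∀ M, B.Reachable M → B.image M ∉ G.bad
  determinism : ∀ p, B.πP p ∈ G.sys → ∀ M, B.Reachable M → M p ≠ 0 →
    {t | p ∈ B.pre t ∧ B.Enabled M t}.Subsingleton
  deadlock_avoiding : ∀ M, B.Reachable M →
    (∃ t₀, G.pre t₀ ⊆ B.image M) → ∃ t, B.Enabled M t

/-- The last known marking of a transition. -/
def lkm (B : LabelledNet P T P₀ T₀) (t : T) : Set P₀ := B.πP '' B.lkc t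

/-- Places of the cut and glued process: the places of `B` minus the future of `C₂` (whose initial
marking `C₂` is kept), and a new copy of each place of the future of `C₁` outside `C₁` (the places
of `C₁` itself have the places of `C₂` as their copies). -/
abbrev GluePlace (B : LabelledNet P T P₀ T₀) (C₁ C₂ : Set P) : Type u :=
  {p : P // p ∉ B.futurePlaces C₂ \ C₂} ⊕ {p : P // p ∈ B.futurePlaces C₁ \ C₁}

/-- Transitions of the cut and glued process: the transitions of `B` outside the future of `C₂`,
and a new copy of each transition of the future of `C₁`. -/
abbrev GlueTransition (B : LabelledNet P T P₀ T₀) (C₁ C₂ : Set P) : Type v :=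
  {t : T // t ∉ B.futureTransitions C₂} ⊕ {t : T // t ∈ B.futureTransitions C₁}

/-- `B.Copy C₁ C₂ p q`: the place `p` of the future of `C₁` has the copy `q`. The copy of a place of
`C₁` is the place of `C₂` with the same label. -/
def Copy (B : LabelledNet P T P₀ T₀) (C₁ C₂ : Set P) (p : P) : B.GluePlace C₁ C₂ → Prop
  | Sum.inl q => p ∈ C₁ ∧ q.1 ∈ C₂ ∧ B.πP q.1 = B.πP p
  | Sum.inr q => q.1 = p

/-- `B.Rename C₁ C₂ p q`: next to a transition outside the future of `C₂`, the place `p` of `B`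
becomes `q`. A place that is kept stays the same. A removed place that depends, among the places of
`C₂`, on places of `C₁ ∩ C₂` only, belongs to both futures, and is renamed to its copy. -/
def Rename (B : LabelledNet P T P₀ T₀) (C₁ C₂ : Set P) (p : P) : B.GluePlace C₁ C₂ → Prop
  | Sum.inl q => q.1 = p
  | Sum.inr q => q.1 = p ∧ p ∈ B.futurePlaces C₂ \ C₂ ∧
      ∀ c ∈ C₂, B.Le (Sum.inl c) (Sum.inl p) → c ∈ C₁

/-- The cut and glued process: `B` with the future of `C₂` replaced by a copy of the future of
`C₁`. -/
def cutGlue (B : LabelledNet P T P₀ T₀) (C₁ C₂ : Set P) :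
    LabelledNet (B.GluePlace C₁ C₂) (B.GlueTransition C₁ C₂) P₀ T₀ where
  pre := Sum.elim (fun t => {q | ∃ p ∈ B.pre t.1, B.Rename C₁ C₂ p q})
    (fun t => {q | ∃ p ∈ B.pre t.1, B.Copy C₁ C₂ p q})
  post := Sum.elim (fun t => {q | ∃ p ∈ B.post t.1, B.Rename C₁ C₂ p q})
    (fun t => {q | ∃ p ∈ B.post t.1, B.Copy C₁ C₂ p q})
  init := {q | ∃ p ∈ B.init, B.Rename C₁ C₂ p q}
  πP := Sum.elim (fun p => B.πP p.1) (fun p => B.πP p.1)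
  πT := Sum.elim (fun t => B.πT t.1) (fun t => B.πT t.1)

/-- The cut `C₂` of `B` is imitable by the cut `C₁`. -/
def IsImitableBy (B : LabelledNet P T P₀ T₀) (G : PetriGame P₀ T₀) (C₂ C₁ : Set P) : Prop :=
  B.IsCut C₁ ∧ B.IsCut C₂ ∧ (B.cutGlue C₁ C₂).IsWinning G

/-- The last known cuts of `t₁` and `t₂` are partial repetition cuts. -/
def Prc (B : LabelledNet P T P₀ T₀) (t₁ t₂ : T) : Prop :=
  B.lkm t₁ = B.lkm t₂ ∧ B.lkc t₁ \ B.post t₁ = B.lkc t₂ \ B.post t₂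

end LabelledNet

/-!
The proof turns on configurations: producer-closed sets of transitions with disjoint presets. In an
occurrence net the reachable markings are exactly the cuts of finite configurations
(`Net.IsOccurrenceNet.exists_config_of_reachable`, `Net.IsOccurrenceNet.reachable_cut`). The last
known cut of `t` is the cut of the causes of `t`, and, as the underlying net is safe, labels are
injective on every such cut.

If the two last known cuts are equal, then cutting and gluing merely replaces a future by its own
copy, and the result is isomorphic to `σ` (`LabelledNet.IsWinning.cutGlue_self`). This covers
`t₁ = t₂` and empty postsets. Empty postsets have to be treated apart because a transition without
postset lies in the future of its own last known cut.

Otherwise the future of the last known cut of `t` consists of the nodes that are neither causes of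
`t` nor in conflict with it (`Net.After`, `Net.IsOccurrenceNet.inFuture_lkc_iff`). Since the two
cuts agree outside the postsets, the nodes of one future which do not depend on its transition are
the same for both (`Net.IsOccurrenceNet.after_of_lkc_sdiff_eq`). On this common part copying and
renaming agree, so as long as `t₂` has not fired, the glued process behaves like `σ`. When `t₂`
fires, the common transitions fired so far could have been fired after `t₁` instead, and from then
on the glued process behaves like `σ` after `t₁` (`exists_config_relImage_copy`). Hence every
reachable marking of the glued process matches a reachable marking of `σ`, with the same labels,
corresponding enabled transitions and no new kinds of consumers (`LabelledNet.IsMatch`), which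
carries all winning conditions over (`LabelledNet.IsWinning.of_isMatch`).

That the glued process is an occurrence net is seen from a measure increasing along its flow
(`LabelledNet.IsGluePair.measure`), and from conflict-free sets containing the causes of each
transition (`isPreconfig_kept`, `isPreconfig_copy`).
-/

/-! ### Causality and conflict -/

namespace Net

variable {P : Type u} {T : Type v} {N : Net P T}

theorem Le.trans {x y z : P ⊕ T} (h : N.Le x y) (h' : N.Le y z) : N.Le x z :=
  Relation.ReflTransGen.trans h h'

theorem Le.refl (x : P ⊕ T) : N.Le x x := Relation.ReflTransGen.refl

theorem Lt.le {x y : P ⊕ T} (h : N.Lt x y) : N.Le x y := Relation.TransGen.to_reflTransGen h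

theorem Le.eq_or_lt {x y : P ⊕ T} (h : N.Le x y) : y = x ∨ N.Lt x y :=
  Relation.reflTransGen_iff_eq_or_transGen.1 h

theorem le_of_mem_pre {p : P} {t : T} (h : p ∈ N.pre t) : N.Le (Sum.inl p) (Sum.inr t) :=
  Relation.ReflTransGen.single h

theorem le_of_mem_post {p : P} {t : T} (h : p ∈ N.post t) : N.Le (Sum.inr t) (Sum.inl p) :=
  Relation.ReflTransGen.single h

theorem lt_of_mem_pre_of_le {p : P} {t : T} {x : P ⊕ T} (h : p ∈ N.pre t)
    (h' : N.Le (Sum.inr t) x) : N.Lt (Sum.inl p) x :=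
  Relation.TransGen.head' (b := Sum.inr t) h h'

theorem le_inl_cases {x : P ⊕ T} {p : P} (h : N.Le x (Sum.inl p)) :
    x = Sum.inl p ∨ ∃ t, p ∈ N.post t ∧ N.Le x (Sum.inr t) := by
  rcases Relation.ReflTransGen.cases_tail h with h | ⟨y, hy, hf⟩
  · exact .inl h.symm
  · rcases y with q | t
    · exact hf.elim
    · exact .inr ⟨t, hf, hy⟩

theorem le_inr_cases {x : P ⊕ T} {t : T} (h : N.Le x (Sum.inr t)) :
    x = Sum.inr t ∨ ∃ p ∈ N.pre t, N.Le x (Sum.inl p) := by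
  rcases Relation.ReflTransGen.cases_tail h with h | ⟨y, hy, hf⟩
  · exact .inl h.symm
  · rcases y with q | t
    · exact .inr ⟨q, hf, hy⟩
    · exact hf.elim

theorem inl_le_cases {x : P ⊕ T} {p : P} (h : N.Le (Sum.inl p) x) :
    x = Sum.inl p ∨ ∃ t, p ∈ N.pre t ∧ N.Le (Sum.inr t) x := by
  rcases Relation.ReflTransGen.cases_head h with h | ⟨y, hf, hy⟩
  · exact .inl h.symm
  · rcases y with q | t
    · exact hf.elim
    · exact .inr ⟨t, hf, hy⟩

theorem inl_le_inr {p : P} {t : T} (h : N.Le (Sum.inl p) (Sum.inr t)) :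
    ∃ s, p ∈ N.pre s ∧ N.Le (Sum.inr s) (Sum.inr t) :=
  (inl_le_cases h).resolve_left (by simp)

theorem inr_le_inl {p : P} {t : T} (h : N.Le (Sum.inr t) (Sum.inl p)) :
    ∃ s, p ∈ N.post s ∧ N.Le (Sum.inr t) (Sum.inr s) :=
  (le_inl_cases h).resolve_left (by simp)

theorem Conflict.symm {x y : P ⊕ T} (h : N.Conflict x y) : N.Conflict y x := by
  obtain ⟨s, s', hne, hp, h1, h2⟩ := h
  exact ⟨s', s, hne.symm, by rwa [Set.inter_comm], h2, h1⟩

theorem Conflict.mono {x y x' y' : P ⊕ T} (h : N.Conflict x y) (hx : N.Le x x')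
    (hy : N.Le y y') : N.Conflict x' y' := by
  obtain ⟨s, s', hne, hp, h1, h2⟩ := h
  exact ⟨s, s', hne, hp, h1.trans hx, h2.trans hy⟩

theorem conflict_of_mem_pre {p : P} {s s' : T} (hne : s ≠ s') (h : p ∈ N.pre s)
    (h' : p ∈ N.pre s') {x y : P ⊕ T} (hx : N.Le (Sum.inr s) x) (hy : N.Le (Sum.inr s') y) :
    N.Conflict x y :=
  ⟨s, s', hne, ⟨p, h, h'⟩, hx, hy⟩

/-- The number of causal predecessors of a node. -/
noncomputable def rank (N : Net P T) (x : P ⊕ T) : ℕ := {y | N.Le y x}.ncard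

namespace IsOccurrenceNet

variable (hN : N.IsOccurrenceNet)
include hN

theorem not_lt_of_le {x y : P ⊕ T} (h : N.Le x y) : ¬ N.Lt y x :=
  fun h' => hN.acyclic _ (Relation.TransGen.trans_left h' h)

theorem producer_unique {p : P} {s t : T} (hs : p ∈ N.post s) (ht : p ∈ N.post t) : s = t :=
  hN.pre_place_subsingleton p hs ht

theorem le_antisymm {x y : P ⊕ T} (h : N.Le x y) (h' : N.Le y x) : x = y := by
  rcases h'.eq_or_lt with h' | h'
  · exact h'
  · exact absurd h' (hN.not_lt_of_le h)

theorem le_producer {p : P} {s t : T} (h : N.Le (Sum.inr s) (Sum.inl p)) (ht : p ∈ N.post t) :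
    N.Le (Sum.inr s) (Sum.inr t) := by
  obtain ⟨u, hu, hsu⟩ := inr_le_inl h
  rwa [hN.producer_unique ht hu]

theorem not_conflict_self (x : P ⊕ T) : ¬ N.Conflict x x := by
  rcases x with p | t
  · rintro ⟨s, s', hne, hp, h1, h2⟩
    obtain ⟨t, ht, hst⟩ := inr_le_inl h1
    exact hN.no_self_conflict t ⟨s, s', hne, hp, hst, hN.le_producer h2 ht⟩
  · exact hN.no_self_conflict t

theorem conflict_producer {p : P} {t : T} {x : P ⊕ T} (h : N.Conflict (Sum.inl p) x)
    (ht : p ∈ N.post t) : N.Conflict (Sum.inr t) x := by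
  obtain ⟨s, s', hne, hp, h1, h2⟩ := h
  exact ⟨s, s', hne, hp, hN.le_producer h1 ht, h2⟩

theorem rank_lt_rank {x y : P ⊕ T} (h : N.Flow x y) : rank N x < rank N y := by
  refine Set.ncard_lt_ncard ⟨fun z hz => Relation.ReflTransGen.tail hz h, fun hs => ?_⟩
    (hN.finitely_preceded y)
  exact hN.acyclic x (Relation.TransGen.head' h (hs (Le.refl y)))

end IsOccurrenceNet

/-! ### Configurations and reachable markings -/

/-- The marking after all transitions of `X` have fired. -/
def cut (N : Net P T) (X : Set T) : Set P :=
  {p | (∀ t, p ∈ N.post t → t ∈ X) ∧ ∀ t ∈ X, p ∉ N.pre t}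

/-- Producer-closed sets of transitions with pairwise disjoint presets. In terms of causality and
conflict: downward closed and conflict-free. -/
structure IsPreconfig (N : Net P T) (X : Set T) : Prop where
  closed : ∀ t ∈ X, ∀ p ∈ N.pre t, ∀ s, p ∈ N.post s → s ∈ X
  eq_of_mem_pre : ∀ s ∈ X, ∀ t ∈ X, ∀ p, p ∈ N.pre s → p ∈ N.pre t → s = t

/-- Configurations: the sets of transitions that occur in a firing sequence. -/
structure IsConfig (N : Net P T) (X : Set T) : Prop extends N.IsPreconfig X where
  finite : X.Finite

namespace IsPreconfig

variable {X : Set T} (hX : N.IsPreconfig X)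
include hX

theorem mem_of_le {s t : T} (h : N.Le (Sum.inr s) (Sum.inr t)) (ht : t ∈ X) : s ∈ X := by
  -- nodes below `X`: its transitions and the places produced or consumed by them
  have key : ∀ y, N.Le y (Sum.inr t) →
      Sum.elim (fun p => ∀ s, p ∈ N.post s → s ∈ X) (· ∈ X) y := by
    intro y hy
    induction hy using Relation.ReflTransGen.head_induction_on with
    | refl => exact ht
    | @head a b hf _ ih =>
      rcases a with p | a <;> rcases b with q | b
      · exact hf.elim
      · exact hX.closed b ih p hf
      · exact ih a hf
      · exact hf.elim
  exact key _ h

theorem not_conflict {s t : T} (hs : s ∈ X) (ht : t ∈ X) :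
    ¬ N.Conflict (Sum.inr s) (Sum.inr t) := by
  rintro ⟨a, b, hne, ⟨p, hpa, hpb⟩, ha, hb⟩
  exact hne (hX.eq_of_mem_pre a (hX.mem_of_le ha hs) b (hX.mem_of_le hb ht) p hpa hpb)

theorem mem_of_le_cut {s : T} {p : P} (h : N.Le (Sum.inr s) (Sum.inl p)) (hp : p ∈ N.cut X) :
    s ∈ X := by
  obtain ⟨t, ht, hst⟩ := inr_le_inl h
  exact hX.mem_of_le hst (hp.1 t ht)

theorem not_lt_of_mem_cut {p : P} {t : T} (hp : p ∈ N.cut X) (ht : t ∈ X) :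
    ¬ N.Le (Sum.inl p) (Sum.inr t) := by
  intro h
  obtain ⟨s, hs, hst⟩ := inl_le_inr h
  exact hp.2 s (hX.mem_of_le hst ht) hs

theorem not_conflict_cut {p : P} {t : T} (hp : p ∈ N.cut X) (ht : t ∈ X) :
    ¬ N.Conflict (Sum.inl p) (Sum.inr t) := by
  rintro ⟨a, b, hne, ⟨q, hqa, hqb⟩, ha, hb⟩
  exact hne (hX.eq_of_mem_pre a (hX.mem_of_le_cut ha hp) b (hX.mem_of_le hb ht) q hqa hqb)

theorem cut_pairwise_concurrent :
    (N.cut X).Pairwise fun p q => N.Concurrent (Sum.inl p) (Sum.inl q) := by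
  have key : ∀ p ∈ N.cut X, ∀ q ∈ N.cut X, p ≠ q → ¬ N.Le (Sum.inl p) (Sum.inl q) := by
    intro p hp q hq hne h
    rcases inl_le_cases h with h | ⟨t, ht, htq⟩
    · exact hne (Sum.inl_injective h).symm
    · exact hp.2 t (hX.mem_of_le_cut htq hq) ht
  intro p hp q hq hne
  refine ⟨key p hp q hq hne, key q hq p hp hne.symm, ?_⟩
  rintro ⟨a, b, hab, ⟨r, hra, hrb⟩, ha, hb⟩
  exact hab (hX.eq_of_mem_pre a (hX.mem_of_le_cut ha hp) b (hX.mem_of_le_cut hb hq) r hra hrb)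

theorem insert {t : T} (ht : N.pre t ⊆ N.cut X) : N.IsPreconfig (insert t X) where
  closed := by
    rintro s (rfl | hs) p hp r hr
    · exact .inr ((ht hp).1 r hr)
    · exact .inr (hX.closed s hs p hp r hr)
  eq_of_mem_pre := by
    rintro s (rfl | hs) r (rfl | hr) p hp hp'
    · rfl
    · exact absurd hp' ((ht hp).2 r hr)
    · exact absurd hp ((ht hp').2 s hs)
    · exact hX.eq_of_mem_pre s hs r hr p hp hp'

end IsPreconfig

theorem IsConfig.insert {X : Set T} (hX : N.IsConfig X) {t : T} (ht : N.pre t ⊆ N.cut X) :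
    N.IsConfig (insert t X) :=
  ⟨hX.toIsPreconfig.insert ht, hX.finite.insert t⟩

theorem isConfig_empty : N.IsConfig ∅ :=
  ⟨⟨fun _ h => h.elim, fun _ h => h.elim⟩, Set.finite_empty⟩

theorem setOf_indicator_ne_zero (S : Set P) :
    {p | S.indicator (1 : P → ℕ) p ≠ 0} = S := by
  ext p
  simp

theorem enabled_indicator {S : Set P} {t : T} : N.Enabled (S.indicator 1) t ↔ N.pre t ⊆ S := by
  refine forall₂_congr fun p _ => ?_
  by_cases h : p ∈ S <;> simp [h]

theorem fire_indicator {S : Set P} {t : T} (hpre : N.pre t ⊆ S)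
    (hpost : Disjoint (S \ N.pre t) (N.post t)) :
    N.fire (S.indicator 1) t = (S \ N.pre t ∪ N.post t).indicator 1 := by
  funext p
  have h1 : p ∈ N.pre t → p ∈ S := fun h => hpre h
  have h2 : p ∈ S → p ∉ N.pre t → p ∉ N.post t :=
    fun h h' h'' => Set.disjoint_left.1 hpost ⟨h, h'⟩ h''
  by_cases ha : p ∈ S <;> by_cases hb : p ∈ N.pre t <;> by_cases hc : p ∈ N.post t <;>
    simp_all [fire]

theorem lkc_eq_cut (t : T) : N.lkc t = N.cut {s | N.Le (Sum.inr s) (Sum.inr t)} := by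
  ext p
  refine ⟨fun h => ⟨h.2, fun s hs hp => h.1 (lt_of_mem_pre_of_le hp hs)⟩,
    fun h => ⟨fun h' => ?_, h.1⟩⟩
  obtain ⟨s, hs, hst⟩ := inl_le_inr h'.le
  exact h.2 s hst hs

namespace IsOccurrenceNet

variable (hN : N.IsOccurrenceNet)
include hN

theorem cut_empty : N.cut ∅ = N.init := by
  rw [hN.init_eq]
  ext p
  simp [cut, Set.eq_empty_iff_forall_notMem]

theorem notMem_of_pre_subset_cut {X : Set T} {t : T} (ht : N.pre t ⊆ N.cut X) : t ∉ X := by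
  intro h
  obtain ⟨p, hp⟩ := hN.pre_nonempty t
  exact (ht hp).2 t h hp

theorem disjoint_cut_post {X : Set T} {t : T} (ht : N.pre t ⊆ N.cut X) :
    Disjoint (N.cut X) (N.post t) :=
  Set.disjoint_left.2 fun _ hp hp' => hN.notMem_of_pre_subset_cut ht (hp.1 t hp')

theorem cut_insert {X : Set T} (hX : N.IsPreconfig X) {t : T} (ht : N.pre t ⊆ N.cut X) :
    N.cut (insert t X) = N.cut X \ N.pre t ∪ N.post t := by
  ext p
  constructor
  · rintro ⟨h1, h2⟩
    by_cases hp : p ∈ N.post t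
    · exact .inr hp
    · refine .inl ⟨⟨fun s hs => ?_, fun s hs => h2 s (.inr hs)⟩, h2 t (.inl rfl)⟩
      exact (h1 s hs).resolve_left fun h => hp (h ▸ hs)
  · rintro (⟨⟨h1, h2⟩, h3⟩ | hp)
    · refine ⟨fun s hs => .inr (h1 s hs), ?_⟩
      rintro s (rfl | hs)
      exacts [h3, h2 s hs]
    · refine ⟨fun s hs => .inl (hN.producer_unique hs hp), ?_⟩
      rintro s (rfl | hs) h
      · exact hN.not_lt_of_le (le_of_mem_post hp) (lt_of_mem_pre_of_le h (Le.refl _))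
      · exact hN.notMem_of_pre_subset_cut ht (hX.closed s hs p h t hp)

theorem fire_cut {X : Set T} (hX : N.IsPreconfig X) {t : T} (ht : N.pre t ⊆ N.cut X) :
    N.fire ((N.cut X).indicator 1) t = (N.cut (insert t X)).indicator 1 := by
  rw [fire_indicator ht ((hN.disjoint_cut_post ht).mono_left Set.sdiff_subset), hN.cut_insert hX ht]

theorem exists_config_of_reachable {M : P → ℕ} (h : N.Reachable M) :
    ∃ X, N.IsConfig X ∧ M = (N.cut X).indicator 1 := by
  induction h with
  | init => exact ⟨∅, isConfig_empty, by rw [hN.cut_empty]⟩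
  | step M t _ ht ih =>
    obtain ⟨X, hX, rfl⟩ := ih
    rw [enabled_indicator] at ht
    exact ⟨_, hX.insert ht, hN.fire_cut hX.toIsPreconfig ht⟩

theorem reachable_cut {X : Set T} (hX : N.IsConfig X) :
    N.Reachable ((N.cut X).indicator 1) := by
  induction h : X.ncard generalizing X with
  | zero =>
    rw [(Set.ncard_eq_zero hX.finite).1 h, hN.cut_empty]
    exact .init
  | succ n ih =>
    have hne : X.Nonempty := Set.nonempty_of_ncard_ne_zero (by omega)
    -- no transition of `X` depends on one of maximal rank, which can therefore fire last
    obtain ⟨t, ht, hmax⟩ := hX.finite.exists_maximalFor (fun t => rank N (Sum.inr t)) X hne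
    have hY : N.IsConfig (X \ {t}) := by
      refine ⟨⟨fun s hs p hp r hr => ⟨hX.closed s hs.1 p hp r hr, ?_⟩,
        fun s hs r hr => hX.eq_of_mem_pre s hs.1 r hr.1⟩, hX.finite.subset Set.sdiff_subset⟩
      rintro rfl
      have h1 : rank N (Sum.inr r) < rank N (Sum.inr s) :=
        (hN.rank_lt_rank (x := Sum.inr r) (y := Sum.inl p) hr).trans
          (hN.rank_lt_rank (x := Sum.inl p) (y := Sum.inr s) hp)
      exact absurd (hmax hs.1 h1.le) (not_le.2 h1)
    have hpre : N.pre t ⊆ N.cut (X \ {t}) := by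
      refine fun p hp => ⟨fun s hs => ⟨hX.closed t ht p hp s hs, ?_⟩, fun s hs hp' =>
        hs.2 (hX.eq_of_mem_pre s hs.1 t ht p hp' hp)⟩
      rintro rfl
      exact hN.not_lt_of_le (le_of_mem_post hs) (lt_of_mem_pre_of_le hp (Le.refl _))
    have hc := ih hY (by rw [Set.ncard_sdiff_singleton_of_mem ht, h]; rfl)
    have := Reachable.step _ t hc (enabled_indicator.2 hpre)
    rwa [hN.fire_cut hY.toIsPreconfig hpre, Set.insert_sdiff_singleton,
      Set.insert_eq_of_mem ht] at this

theorem isPreconfig_le (x : P ⊕ T) : N.IsPreconfig {s | N.Le (Sum.inr s) x} where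
  closed _ hs _ hp _ hr := ((le_of_mem_post hr).trans (le_of_mem_pre hp)).trans hs
  eq_of_mem_pre s hs r hr p hp hp' := by
    by_contra hne
    exact hN.not_conflict_self x (conflict_of_mem_pre hne hp hp' hs hr)

theorem isConfig_le (x : P ⊕ T) : N.IsConfig {s | N.Le (Sum.inr s) x} :=
  ⟨hN.isPreconfig_le x, (hN.finitely_preceded x).preimage Sum.inr_injective.injOn⟩

theorem isCut_lkc (t : T) : N.IsCut (N.lkc t) :=
  ⟨_, hN.reachable_cut (hN.isConfig_le (Sum.inr t)), by rw [lkc_eq_cut]; ext p; simp⟩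

/-- A finite set of pairwise concurrent places is covered by a reachable marking: fire all
transitions below it. -/
theorem exists_config_of_concurrent {C : Set P} (hfin : C.Finite)
    (hC : C.Pairwise fun p q => N.Concurrent (Sum.inl p) (Sum.inl q)) :
    ∃ X, N.IsConfig X ∧ C ⊆ N.cut X := by
  refine ⟨⋃ p ∈ C, {s | N.Le (Sum.inr s) (Sum.inl p)}, ⟨⟨?_, ?_⟩,
    hfin.biUnion fun p _ => (hN.isConfig_le _).finite⟩, fun p hp => ⟨fun t ht => ?_, ?_⟩⟩
  · simp only [Set.mem_iUnion, Set.mem_ofPred_eq]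
    rintro t ⟨q, hq, htq⟩ p hp s hs
    exact ⟨q, hq, ((le_of_mem_post hs).trans (le_of_mem_pre hp)).trans htq⟩
  · simp only [Set.mem_iUnion, Set.mem_ofPred_eq]
    rintro s ⟨p, hp, hsp⟩ t ⟨q, hq, htq⟩ r hrs hrt
    by_contra hne
    have hc := conflict_of_mem_pre hne hrs hrt hsp htq
    by_cases hpq : p = q
    · subst hpq
      exact hN.not_conflict_self _ hc
    · exact (hC hp hq hpq).2.2 hc
  · simp only [Set.mem_iUnion, Set.mem_ofPred_eq]
    exact ⟨p, hp, le_of_mem_post ht⟩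
  · simp only [Set.mem_iUnion, Set.mem_ofPred_eq]
    rintro t ⟨q, hq, htq⟩ hpt
    have hlt := lt_of_mem_pre_of_le hpt htq
    by_cases hpq : p = q
    · subst hpq
      exact hN.acyclic _ hlt
    · exact (hC hp hq hpq).1 hlt.le

end IsOccurrenceNet

end Net

/-! ### Labels on reachable markings -/

namespace LabelledNet

variable {P : Type u} {T : Type v} {P₀ : Type u₀} {T₀ : Type v₀} {B : LabelledNet P T P₀ T₀}

theorem IsHom.image_pre {N₀ : Net P₀ T₀} (h : B.IsHom N₀) (t : T) :
    B.πP '' B.pre t = N₀.pre (B.πT t) :=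
  (h.pre_bijOn t).image_eq

/-- Reachable markings of a branching process of a safe net are mapped injectively to reachable
markings of that net. -/
theorem IsBranchingProc.reachable_image {N₀ : Net P₀ T₀} (hB : B.IsBranchingProc N₀)
    (hs : N₀.IsSafe) {M : P → ℕ} (hM : B.Reachable M) :
    N₀.Reachable ((B.image M).indicator 1) ∧ Set.InjOn B.πP {p | M p ≠ 0} := by
  induction hM with
  | init =>
    rw [image, Net.setOf_indicator_ne_zero, hB.isHom.init_bijOn.image_eq]
    exact ⟨.init, hB.isHom.init_bijOn.injOn⟩
  | step M t hM ht ih =>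
    obtain ⟨X, hX, rfl⟩ := hB.isOccurrenceNet.exists_config_of_reachable hM
    rw [Net.enabled_indicator] at ht
    have hfire := hB.isOccurrenceNet.fire_cut hX.toIsPreconfig ht
    rw [hB.isOccurrenceNet.cut_insert hX.toIsPreconfig ht] at hfire
    simp only [image, Net.setOf_indicator_ne_zero, hfire] at ih ⊢
    generalize B.cut X = S at ih ht
    obtain ⟨hr, hinj⟩ := ih
    have hen : N₀.pre (B.πT t) ⊆ B.πP '' S := by
      rw [← hB.isHom.image_pre]
      exact Set.image_mono ht
    have hr' := Net.Reachable.step _ _ hr (Net.enabled_indicator.2 hen)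
    -- a place of the postset that stays marked would get a second token
    have hdis : Disjoint (B.πP '' S \ N₀.pre (B.πT t)) (N₀.post (B.πT t)) := by
      refine Set.disjoint_left.2 fun p hp hp' => ?_
      have := hs _ hr' p
      simp [Net.fire, hp', hp.1, hp.2] at this
    have himg : B.πP '' (S \ B.pre t ∪ B.post t) =
        B.πP '' S \ N₀.pre (B.πT t) ∪ N₀.post (B.πT t) := by
      rw [Set.image_union, (hB.isHom.post_bijOn t).image_eq, ← hB.isHom.image_pre,
        hinj.image_sdiff_subset ht]
    refine ⟨by rwa [himg, ← Net.fire_indicator hen hdis], ?_⟩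
    have hmem : ∀ p ∈ S \ B.pre t, B.πP p ∈ B.πP '' S \ N₀.pre (B.πT t) := by
      intro p hp
      rw [← hB.isHom.image_pre, ← hinj.image_sdiff_subset ht]
      exact ⟨p, hp, rfl⟩
    have hmem' : ∀ p ∈ B.post t, B.πP p ∈ N₀.post (B.πT t) :=
      fun p hp => (hB.isHom.post_bijOn t).mapsTo hp
    rintro p (hp | hp) q (hq | hq) hpq
    · exact hinj hp.1 hq.1 hpq
    · exact absurd (hpq ▸ hmem' q hq) (Set.disjoint_left.1 hdis (hmem p hp))
    · exact absurd (hpq ▸ hmem' p hp) (Set.disjoint_left.1 hdis (hmem q hq))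
    · exact (hB.isHom.post_bijOn t).injOn hp hq hpq

theorem IsBranchingProc.injOn_cut {N₀ : Net P₀ T₀} (hB : B.IsBranchingProc N₀)
    (hs : N₀.IsSafe) {X : Set T} (hX : B.IsConfig X) : Set.InjOn B.πP (B.cut X) := by
  have := (hB.reachable_image hs (hB.isOccurrenceNet.reachable_cut hX)).2
  rwa [Net.setOf_indicator_ne_zero] at this

/-! ### Transfer of winning strategies along matching markings -/

variable {P' : Type u} {T' : Type v} {B' : LabelledNet P' T' P₀ T₀}

/-- The image of a set under a relation. -/
def relImage (R : P → P' → Prop) (S : Set P) : Set P' := {q | ∃ p ∈ S, R p q}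

theorem relImage_mono {R : P → P' → Prop} {S S' : Set P} (h : S ⊆ S') :
    relImage R S ⊆ relImage R S' :=
  fun _ ⟨p, hp, hq⟩ => ⟨p, h hp, hq⟩

theorem relImage_union {R : P → P' → Prop} {S S' : Set P} :
    relImage R (S ∪ S') = relImage R S ∪ relImage R S' := by
  ext q
  simp only [relImage, Set.mem_union, Set.mem_ofPred_eq, or_and_right, exists_or]

theorem relImage_congr {R R' : P → P' → Prop} {S : Set P}
    (h : ∀ p ∈ S, ∀ q, R p q ↔ R' p q) : relImage R S = relImage R' S := by
  ext q
  exact exists_congr fun p => and_congr_right fun hp => h p hp q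

theorem relImage_sdiff {R : P → P' → Prop} (hR : ∀ p p' q, R p q → R p' q → p = p')
    {S S' : Set P} : relImage R (S \ S') = relImage R S \ relImage R S' := by
  ext q
  constructor
  · rintro ⟨p, hp, hq⟩
    exact ⟨⟨p, hp.1, hq⟩, fun ⟨p', hp', hq'⟩ => hp.2 (hR p p' q hq hq' ▸ hp')⟩
  · rintro ⟨⟨p, hp, hq⟩, h⟩
    exact ⟨p, ⟨hp, fun hp' => h ⟨p, hp', hq⟩⟩, hq⟩

theorem disjoint_relImage {R : P → P' → Prop} (hR : ∀ p p' q, R p q → R p' q → p = p')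
    {S S' : Set P} (h : Disjoint S S') : Disjoint (relImage R S) (relImage R S') :=
  Set.disjoint_left.2 fun q ⟨p, hp, hq⟩ ⟨p', hp', hq'⟩ =>
    Set.disjoint_left.1 h hp (hR p p' q hq hq' ▸ hp')

theorem subset_of_relImage_subset {R : P → P' → Prop}
    (hR : ∀ p p' q, R p q → R p' q → p = p') {S S' : Set P} (htot : ∀ p ∈ S, ∃ q, R p q)
    (h : relImage R S ⊆ relImage R S') : S ⊆ S' := by
  intro p hp
  obtain ⟨q, hq⟩ := htot p hp
  obtain ⟨p', hp', hq'⟩ := h ⟨p, hp, hq⟩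
  exact hR p p' q hq hq' ▸ hp'

theorem bijOn_relImage {R : P → P' → Prop} {S : Set P} {V : Set P₀}
    (hS : Set.BijOn B.πP S V) (htot : ∀ p ∈ S, ∃ q, R p q)
    (hR : ∀ p q q', R p q → R p q' → q = q')
    (hlab : ∀ p q, R p q → B'.πP q = B.πP p) : Set.BijOn B'.πP (relImage R S) V := by
  refine ⟨?_, ?_, ?_⟩
  · rintro q ⟨p, hp, hq⟩
    rw [hlab p q hq]
    exact hS.mapsTo hp
  · rintro q ⟨p, hp, hq⟩ q' ⟨p', hp', hq'⟩ h
    rw [hlab p q hq, hlab p' q' hq'] at h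
    obtain rfl := hS.injOn hp hp' h
    exact hR p q q' hq hq'
  · intro v hv
    obtain ⟨p, hp, rfl⟩ := hS.surjOn hv
    obtain ⟨q, hq⟩ := htot p hp
    exact ⟨q, ⟨p, hp, hq⟩, hlab p q hq⟩

/-- Firing commutes with the image of markings under a left-unique relation. -/
theorem fire_relImage {R : P → P' → Prop} (hR : ∀ p p' q, R p q → R p' q → p = p')
    (hN : B.IsOccurrenceNet) {X : Set T} (hX : B.IsPreconfig X) {t : T} {t' : T'}
    (ht : B.pre t ⊆ B.cut X) (hpre : B'.pre t' = relImage R (B.pre t))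
    (hpost : B'.post t' = relImage R (B.post t)) :
    B'.fire ((relImage R (B.cut X)).indicator 1) t' =
      (relImage R (B.cut (insert t X))).indicator 1 := by
  rw [Net.fire_indicator, hN.cut_insert hX ht, relImage_union, relImage_sdiff hR, hpre, hpost]
  · exact hpre ▸ relImage_mono ht
  · rw [hpost]
    exact (disjoint_relImage hR (hN.disjoint_cut_post ht)).mono_left Set.sdiff_subset

/-- `R` matches the marking `S` of `B` with the marking `relImage R S` of `B'`: it is a
label-preserving bijection between them under which the enabled transitions correspond, and every
consumer of a place of `relImage R S` has a counterpart of the same label in `B`. -/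
structure IsMatch (B : LabelledNet P T P₀ T₀) (B' : LabelledNet P' T' P₀ T₀)
    (R : P → P' → Prop) (S : Set P) : Prop where
  total : ∀ p ∈ S, ∃ q, R p q
  left_unique : ∀ p p' q, R p q → R p' q → p = p'
  label : ∀ p q, R p q → B'.πP q = B.πP p
  consumer : ∀ p ∈ S, ∀ q s', R p q → q ∈ B'.pre s' → ∃ s, B.πT s = B'.πT s' ∧ p ∈ B.pre s
  lower : ∀ s', B'.pre s' ⊆ relImage R S →
    ∃ s, B.πT s = B'.πT s' ∧ B.pre s ⊆ S ∧ B'.pre s' = relImage R (B.pre s)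
  lift : ∀ s, B.pre s ⊆ S → ∃ s', B'.πT s' = B.πT s ∧ B'.pre s' = relImage R (B.pre s)

theorem IsMatch.image_eq {R : P → P' → Prop} {S : Set P} (h : IsMatch B B' R S) :
    B'.image ((relImage R S).indicator 1) = B.image (S.indicator 1) := by
  simp only [image, Net.setOf_indicator_ne_zero]
  ext v
  constructor
  · rintro ⟨q, ⟨p, hp, hq⟩, rfl⟩
    exact ⟨p, hp, (h.label p q hq).symm⟩
  · rintro ⟨p, hp, rfl⟩
    obtain ⟨q, hq⟩ := h.total p hp
    exact ⟨q, ⟨p, hp, hq⟩, h.label p q hq⟩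

theorem IsBranchingProc.finite_of_concurrent {N₀ : Net P₀ T₀} (hB : B.IsBranchingProc N₀)
    (hs : N₀.IsSafe) {C : Set P}
    (hC : C.Pairwise fun p q => B.Concurrent (Sum.inl p) (Sum.inl q))
    (hfin : (B.πP '' C).Finite) : C.Finite := by
  refine Set.Finite.of_finite_image hfin fun p hp q hq h => ?_
  have hsub : ({p, q} : Set P) ⊆ C := by
    rintro x (rfl | rfl) <;> assumption
  obtain ⟨X, hX, hpq⟩ := hB.isOccurrenceNet.exists_config_of_concurrent
    (Set.toFinite {p, q}) (hC.mono hsub)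
  exact hB.injOn_cut hs hX (hpq (.inl rfl)) (hpq (.inr rfl)) h

/-- A branching process all of whose reachable markings match reachable markings of a winning
strategy is a winning strategy. -/
theorem IsWinning.of_isMatch {G : PetriGame P₀ T₀} (hB : B.IsWinning G)
    (hB' : B'.IsBranchingProc G.toNet)
    (h : ∀ M', B'.Reachable M' → ∃ X R, B.IsConfig X ∧ IsMatch B B' R (B.cut X) ∧
      M' = (relImage R (B.cut X)).indicator 1) : B'.IsWinning G where
  isBranchingProc := hB'
  justified_refusal C' t hC' himg hno := by
    have hfin := hB'.finite_of_concurrent G.isSafe hC' (himg ▸ G.isPetriNet.pre_finite t)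
    obtain ⟨X', hX', hsub⟩ := hB'.isOccurrenceNet.exists_config_of_concurrent hfin hC'
    obtain ⟨X, R, hX, hR, hM⟩ := h _ (hB'.isOccurrenceNet.reachable_cut hX')
    have hsub' : C' ⊆ relImage R (B.cut X) := by
      have := congrArg (fun M => {p | M p ≠ 0}) hM
      simp only [Net.setOf_indicator_ne_zero] at this
      rwa [← this]
    have hC : relImage R {p ∈ B.cut X | ∃ q ∈ C', R p q} ⊇ C' := by
      intro q hq
      obtain ⟨p, hp, hpq⟩ := hsub' hq
      exact ⟨p, ⟨hp, q, hq, hpq⟩, hpq⟩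
    obtain ⟨p, ⟨hp, q, hq, hpq⟩, hsys, hcons⟩ :=
      hB.justified_refusal {p ∈ B.cut X | ∃ q ∈ C', R p q} t
        (hX.cut_pairwise_concurrent.mono fun p hp => hp.1)
        (by
          rw [← himg]
          ext v
          constructor
          · rintro ⟨p, ⟨hp, q, hq, hpq⟩, rfl⟩
            exact ⟨q, hq, hR.label p q hpq⟩
          · rintro ⟨q, hq, rfl⟩
            obtain ⟨p, hp, hpq⟩ := hsub' hq
            exact ⟨p, ⟨hp, q, hq, hpq⟩, (hR.label p q hpq).symm⟩)
        (by
          rintro ⟨s, rfl, hs⟩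
          obtain ⟨s', hs't, hs'⟩ := hR.lift s (hs ▸ fun p hp => hp.1)
          have hbij := hB'.isHom.pre_bijOn s'
          refine hno ⟨s', hs't, ?_⟩
          rw [hs', hs]
          refine (Set.Subset.antisymm ?_ hC)
          rintro q ⟨p, ⟨hp, q', hq', hpq'⟩, hpq⟩
          -- `q` and `q'` lie in the preset of `s'` and carry the same label
          have h1 : q ∈ B'.pre s' := hs' ▸ ⟨p, hs ▸ ⟨hp, q', hq', hpq'⟩, hpq⟩
          have h2 : q' ∈ B'.pre s' := hs' ▸ ⟨p, hs ▸ ⟨hp, q', hq', hpq'⟩, hpq'⟩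
          rwa [hbij.injOn h1 h2 (by rw [hR.label p q hpq, hR.label p q' hpq'])])
    refine ⟨q, hq, by rwa [hR.label p q hpq], ?_⟩
    rintro ⟨s', hs', rfl⟩
    obtain ⟨s, hs, hps⟩ := hR.consumer p hp q s' hpq hs'
    exact hcons ⟨s, hps, hs⟩
  safety M' hM' := by
    obtain ⟨X, R, hX, hR, rfl⟩ := h M' hM'
    rw [hR.image_eq]
    exact hB.safety _ (hB.isBranchingProc.isOccurrenceNet.reachable_cut hX)
  determinism q hq M' hM' hqM := by
    obtain ⟨X, R, hX, hR, rfl⟩ := h M' hM'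
    rintro s' ⟨hqs, hs'⟩ r' ⟨hqr, hr'⟩
    obtain ⟨s, hsl, hs, hss⟩ := hR.lower s' (Net.enabled_indicator.1 hs')
    obtain ⟨r, hrl, hr, hrr⟩ := hR.lower r' (Net.enabled_indicator.1 hr')
    obtain ⟨p, hps, hpq⟩ := hss ▸ hqs
    obtain ⟨p', hpr, hpq'⟩ := hrr ▸ hqr
    obtain rfl := hR.left_unique p p' q hpq hpq'
    obtain rfl := hB.determinism p (by rwa [← hR.label p q hpq]) _
      (hB.isBranchingProc.isOccurrenceNet.reachable_cut hX) (by simp [hs hps])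
      ⟨hps, Net.enabled_indicator.2 hs⟩ ⟨hpr, Net.enabled_indicator.2 hr⟩
    exact hB'.eq_of_pre_eq _ _ (hss.trans hrr.symm) (hsl.symm.trans hrl)
  deadlock_avoiding M' hM' ht := by
    obtain ⟨X, R, hX, hR, rfl⟩ := h M' hM'
    rw [hR.image_eq] at ht
    obtain ⟨t, ht⟩ := hB.deadlock_avoiding _
      (hB.isBranchingProc.isOccurrenceNet.reachable_cut hX) ht
    rw [Net.enabled_indicator] at ht
    obtain ⟨s', -, hs'⟩ := hR.lift t ht
    exact ⟨s', Net.enabled_indicator.2 (hs' ▸ relImage_mono ht)⟩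

/-! ### Isomorphic copies of winning strategies -/

/-- An isomorphic copy of a winning strategy is a winning strategy. -/
theorem IsWinning.of_bijective {G : PetriGame P₀ T₀} (hB : B.IsWinning G) {f : P' → P}
    {g : T' → T} (hf : f.Bijective) (hg : g.Bijective)
    (hpre : ∀ t q, q ∈ B'.pre t ↔ f q ∈ B.pre (g t))
    (hpost : ∀ t q, q ∈ B'.post t ↔ f q ∈ B.post (g t))
    (hinit : ∀ q, q ∈ B'.init ↔ f q ∈ B.init)
    (hπP : ∀ q, B'.πP q = B.πP (f q)) (hπT : ∀ t, B'.πT t = B.πT (g t)) :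
    B'.IsWinning G := by
  have hbr := hB.isBranchingProc
  have hN := hbr.isOccurrenceNet
  let R : P → P' → Prop := fun p q => f q = p
  have hRl : ∀ p p' q, R p q → R p' q → p = p' := fun p p' q h h' => h.symm.trans h'
  have hRr : ∀ p q q', R p q → R p q' → q = q' := fun p q q' h h' => hf.1 (h.trans h'.symm)
  have hRlab : ∀ p q, R p q → B'.πP q = B.πP p := fun p q h => by rw [hπP, h]
  have hRtot : ∀ p, ∃ q, R p q := hf.2
  have hRi : ∀ S, relImage R S = f ⁻¹' S := fun S => by
    ext q
    exact ⟨fun ⟨p, hp, h⟩ => by rwa [Set.mem_preimage, h], fun h => ⟨f q, h, rfl⟩⟩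
  have hpre' : ∀ t, B'.pre t = relImage R (B.pre (g t)) := fun t => by
    rw [hRi]; ext q; exact hpre t q
  have hpost' : ∀ t, B'.post t = relImage R (B.post (g t)) := fun t => by
    rw [hRi]; ext q; exact hpost t q
  have hinit' : B'.init = relImage R B.init := by
    rw [hRi]; ext q; exact hinit q
  have hflow : ∀ x y, B'.Flow x y → B.Flow (Sum.map f g x) (Sum.map f g y) := by
    rintro (p | t) (q | s) h
    exacts [h.elim, (hpre s p).1 h, (hpost t q).1 h, h.elim]
  have hle : ∀ x y, B'.Le x y → B.Le (Sum.map f g x) (Sum.map f g y) :=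
    fun x y h => Relation.ReflTransGen.lift _ hflow _ _ h
  have hsum : (Sum.map f g).Injective := Sum.map_injective.2 ⟨hf.1, hg.1⟩
  have hB' : B'.IsBranchingProc G.toNet :=
    { isOccurrenceNet :=
        { pre_finite := fun t => by
            rw [hpre', hRi]
            exact (hN.pre_finite _).preimage hf.1.injOn
          pre_nonempty := fun t => by
            rw [hpre', hRi]
            exact (hN.pre_nonempty _).preimage hf.2
          post_finite := fun t => by
            rw [hpost', hRi]
            exact (hN.post_finite _).preimage hf.1.injOn
          acyclic := fun x h => hN.acyclic _ (Relation.TransGen.lift _ hflow _ _ h)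
          finitely_preceded := fun x =>
            ((hN.finitely_preceded (Sum.map f g x)).preimage hsum.injOn).subset
              fun y hy => hle y x hy
          pre_place_subsingleton := fun p s hs t ht =>
            hg.1 (hN.producer_unique ((hpost s p).1 hs) ((hpost t p).1 ht))
          no_self_conflict := by
            rintro t ⟨s, s', hne, ⟨p, hp, hp'⟩, h, h'⟩
            exact hN.no_self_conflict (g t) (Net.conflict_of_mem_pre (hg.1.ne hne)
              ((hpre s p).1 hp) ((hpre s' p).1 hp') (hle _ _ h) (hle _ _ h'))
          init_eq := by
            ext q
            rw [hinit, hN.init_eq]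
            simp only [Set.mem_ofPred_eq, Set.eq_empty_iff_forall_notMem, hpost]
            exact hg.2.forall }
      isHom :=
        { pre_bijOn := fun t => by
            rw [hpre', hπT]
            exact bijOn_relImage (hbr.isHom.pre_bijOn _) (fun p _ => hRtot p) hRr hRlab
          post_bijOn := fun t => by
            rw [hpost', hπT]
            exact bijOn_relImage (hbr.isHom.post_bijOn _) (fun p _ => hRtot p) hRr hRlab
          init_bijOn := by
            rw [hinit']
            exact bijOn_relImage hbr.isHom.init_bijOn (fun p _ => hRtot p) hRr hRlab }
      eq_of_pre_eq := fun s t h h' => by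
        rw [hpre', hpre', hRi, hRi] at h
        rw [hπT, hπT] at h'
        exact hg.1 (hbr.eq_of_pre_eq _ _ (hf.2.preimage_injective h) h') }
  refine hB.of_isMatch hB' fun M' hM' => ?_
  obtain ⟨X, hX, rfl⟩ : ∃ X, B.IsConfig X ∧ M' = (relImage R (B.cut X)).indicator 1 := by
    induction hM' with
    | init => exact ⟨∅, Net.isConfig_empty, by rw [hN.cut_empty, hinit']⟩
    | step M t _ ht ih =>
      obtain ⟨X, hX, rfl⟩ := ih
      have hen := subset_of_relImage_subset hRl (fun p _ => hRtot p)
        (hpre' t ▸ Net.enabled_indicator.1 ht)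
      exact ⟨_, hX.insert hen, fire_relImage hRl hN hX.toIsPreconfig hen (hpre' t) (hpost' t)⟩
  refine ⟨X, R, hX, ⟨fun p _ => hRtot p, hRl, hRlab, ?_, ?_, ?_⟩, rfl⟩
  · rintro p - q s' rfl hq
    exact ⟨g s', (hπT s').symm, (hpre s' q).1 hq⟩
  · intro s' hs'
    exact ⟨g s', (hπT s').symm,
      subset_of_relImage_subset hRl (fun p _ => hRtot p) (hpre' s' ▸ hs'), hpre' s'⟩
  · intro s hs
    obtain ⟨s', rfl⟩ := hg.2 s
    exact ⟨s', hπT s', hpre' s'⟩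

end LabelledNet

/-! ### The future of the last known cut -/

namespace Net

variable {P : Type u} {T : Type v} {N : Net P T}

/-- The node `x` can occur after the local configuration of `t`: it is neither a cause of `t` (nor
`t` itself) nor in conflict with `t`. -/
def After (N : Net P T) (t : T) (x : P ⊕ T) : Prop :=
  ¬ N.Le x (Sum.inr t) ∧ ¬ N.Conflict x (Sum.inr t)

theorem not_after_self (t : T) : ¬ N.After t (Sum.inr t) := fun h => h.1 (Le.refl _)

theorem le_of_le_lkc {t : T} {s : T} {c : P} (h : N.Le (Sum.inr s) (Sum.inl c)) (hc : c ∈ N.lkc t) :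
    N.Le (Sum.inr s) (Sum.inr t) := by
  obtain ⟨r, hr, hsr⟩ := inr_le_inl h
  exact hsr.trans (hc.2 r hr)

theorem not_lkc_le {t : T} {c : P} (hc : c ∈ N.lkc t) : ¬ N.Le (Sum.inl c) (Sum.inr t) := fun h =>
  hc.1 (h.eq_or_lt.resolve_left (by simp))

theorem After.of_mem_pre {t : T} {s : T} {p : P} (hs : N.After t (Sum.inr s)) (hp : p ∈ N.pre s) :
    N.After t (Sum.inl p) := by
  refine ⟨fun h => ?_, fun h => hs.2 (h.mono (le_of_mem_pre hp) (Le.refl _))⟩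
  obtain ⟨r, hr, hrt⟩ := inl_le_inr h
  by_cases hsr : s = r
  · exact hs.1 (hsr ▸ hrt)
  · exact hs.2 (conflict_of_mem_pre hsr hp hr (Le.refl _) hrt)

theorem After.notMem_lkc {t : T} {s : T} {p : P} (hs : N.After t (Sum.inr s)) (hp : p ∈ N.post s) :
    p ∉ N.lkc t := fun h => hs.1 (h.2 s hp)

theorem After.exists_producer {t : T} {p : P} (hp : N.After t (Sum.inl p)) (hc : p ∉ N.lkc t) :
    ∃ s, p ∈ N.post s := by
  by_contra! h
  exact hc ⟨fun hlt => hp.1 hlt.le, fun r hr => absurd hr (h r)⟩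

theorem after_of_mem_cut {t : T} {X : Set T} (hX : N.IsPreconfig X) (ht : t ∈ X) {p : P}
    (hp : p ∈ N.cut X) : N.After t (Sum.inl p) :=
  ⟨hX.not_lt_of_mem_cut hp ht, hX.not_conflict_cut hp ht⟩

namespace IsOccurrenceNet

variable (hN : N.IsOccurrenceNet) {t : T}
include hN

theorem post_subset_lkc (t : T) : N.post t ⊆ N.lkc t := fun p hp =>
  ⟨fun h => hN.acyclic _ (Relation.TransGen.tail h hp),
    fun s hs => by rw [hN.producer_unique hs hp]; exact Le.refl _⟩

theorem not_le_of_mem_lkc_sdiff {c : P} (hc : c ∈ N.lkc t) (hc' : c ∉ N.post t) :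
    ¬ N.Le (Sum.inr t) (Sum.inl c) := by
  intro h
  obtain ⟨s, hs, hts⟩ := inr_le_inl h
  obtain rfl := Sum.inr_injective (hN.le_antisymm hts (hc.2 s hs))
  exact hc' hs

theorem after_of_mem_lkc {c : P} (hc : c ∈ N.lkc t) : N.After t (Sum.inl c) := by
  refine ⟨not_lkc_le hc, ?_⟩
  rintro ⟨s, s', hne, hp, h, h'⟩
  exact hN.no_self_conflict t ⟨s, s', hne, hp, le_of_le_lkc h hc, h'⟩

/-- For a transition with nonempty postset, the future of its last known cut consists of the nodes
that can occur after it. (If the postset is empty, the transition itself lies in that future.) -/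
theorem inFuture_lkc_iff (hne : (N.post t).Nonempty) {x : P ⊕ T} :
    N.InFuture (N.lkc t) x ↔ N.After t x := by
  constructor
  · intro h
    obtain ⟨c, hc⟩ := hne
    have htc := le_of_mem_post hc
    refine ⟨fun hx => ?_, fun hx => ?_⟩
    · rcases h c (hN.post_subset_lkc t hc) with h | h
      · exact not_lkc_le (hN.post_subset_lkc t hc) (h.trans hx)
      · exact h.2.1 (hx.trans htc)
    · rcases h c (hN.post_subset_lkc t hc) with h | h
      · exact hN.not_conflict_self x (hx.mono (Le.refl _) (htc.trans h))
      · exact h.2.2 (hx.symm.mono htc (Le.refl _))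
  · intro h c hc
    by_cases hcx : N.Le (Sum.inl c) x
    · exact .inl hcx
    refine .inr ⟨hcx, fun hxc => ?_, ?_⟩
    · rcases le_inl_cases hxc with rfl | ⟨s, hs, hxs⟩
      · exact hcx (Le.refl _)
      · exact h.1 (hxs.trans (hc.2 s hs))
    · rintro ⟨s, s', hne, hp, hs, hs'⟩
      exact h.2 (Conflict.symm ⟨s, s', hne, hp, le_of_le_lkc hs hc, hs'⟩)

theorem after_of_forall_mem_pre {s : T} (hs : ∀ p ∈ N.pre s, N.After t (Sum.inl p)) :
    N.After t (Sum.inr s) := by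
  refine ⟨fun h => ?_, ?_⟩
  · obtain ⟨p, hp⟩ := hN.pre_nonempty s
    exact (hs p hp).1 ((le_of_mem_pre hp).trans h)
  · rintro ⟨r, r', hne, ⟨q, hq, hq'⟩, hr, hr'⟩
    rcases le_inr_cases hr with hr | ⟨p, hp, hrp⟩
    · obtain rfl := Sum.inr_injective hr
      exact (hs q hq).1 ((le_of_mem_pre hq').trans hr')
    · exact (hs p hp).2 (conflict_of_mem_pre hne hq hq' hrp hr')

theorem _root_.Net.After.of_mem_post {s : T} {p : P} (hs : N.After t (Sum.inr s))
    (hp : p ∈ N.post s) : N.After t (Sum.inl p) :=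
  ⟨fun h => hs.1 ((le_of_mem_post hp).trans h), fun h => hs.2 (hN.conflict_producer h hp)⟩

theorem _root_.Net.After.producer {s : T} {p : P} (hp : N.After t (Sum.inl p)) (hps : p ∈ N.post s)
    (hc : p ∉ N.lkc t) : N.After t (Sum.inr s) := by
  refine ⟨fun h => hc ⟨fun hlt => hp.1 hlt.le, fun r hr => ?_⟩,
    fun h => hp.2 (h.mono (le_of_mem_post hps) (Le.refl _))⟩
  rwa [hN.producer_unique hr hps]

theorem _root_.Net.After.exists_lkc_le {x : P ⊕ T} (hx : N.After t x) :
    ∃ c ∈ N.lkc t, N.Le (Sum.inl c) x := by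
  induction h : rank N x using Nat.strong_induction_on generalizing x with
  | _ n ih =>
    subst h
    rcases x with p | s
    · by_cases hp : p ∈ N.lkc t
      · exact ⟨p, hp, Le.refl _⟩
      obtain ⟨s, hs⟩ := hx.exists_producer hp
      obtain ⟨c, hc, hcs⟩ :=
        ih _ (hN.rank_lt_rank (x := Sum.inr s) (y := Sum.inl p) hs) (hx.producer hN hs hp) rfl
      exact ⟨c, hc, hcs.trans (le_of_mem_post hs)⟩
    · obtain ⟨p, hp⟩ := hN.pre_nonempty s
      obtain ⟨c, hc, hcp⟩ :=
        ih _ (hN.rank_lt_rank (x := Sum.inl p) (y := Sum.inr s) hp) (hx.of_mem_pre hp) rfl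
      exact ⟨c, hc, hcp.trans (le_of_mem_pre hp)⟩

/-- Every path from a cause of `t` to a node after `t` crosses the last known cut of `t`. -/
theorem _root_.Net.After.exists_lkc_between {x y : P ⊕ T} (hx : N.After t x) (hyx : N.Le y x)
    (hy : N.Le y (Sum.inr t)) : ∃ c ∈ N.lkc t, N.Le y (Sum.inl c) ∧ N.Le (Sum.inl c) x := by
  induction hyx using Relation.ReflTransGen.head_induction_on with
  | refl => exact absurd hy hx.1
  | @head y z hf hzx ih =>
    by_cases hz : N.Le z (Sum.inr t)
    · obtain ⟨c, hc, hzc, hcx⟩ := ih hz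
      exact ⟨c, hc, Relation.ReflTransGen.head hf hzc, hcx⟩
    rcases y with p | r <;> rcases z with q | s
    · exact hf.elim
    · obtain ⟨u, hu, hut⟩ := inl_le_inr hy
      refine absurd (Conflict.mono ?_ hzx hut) hx.2
      exact conflict_of_mem_pre (fun h : s = u => hz (h ▸ hut)) hf hu (Le.refl _) (Le.refl _)
    · refine ⟨q, ⟨fun h => hz h.le, fun u hu => ?_⟩, le_of_mem_post hf, hzx⟩
      rwa [hN.producer_unique hu hf]
    · exact hf.elim

theorem eq_of_le_of_not_after {s : T} (h : N.Le (Sum.inr t) (Sum.inr s))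
    (hs : ¬ N.After t (Sum.inr s)) : s = t := by
  by_contra hne
  refine hs ⟨fun h' => hne (Sum.inr_injective (hN.le_antisymm h' h)), fun h' => ?_⟩
  exact hN.no_self_conflict s (h'.mono (Le.refl _) h)

/-- A place after `t` that is consumed by a transition not after `t` does not depend on `t`. -/
theorem not_le_of_mem_pre_of_not_after {s : T} {p : P} (hs : ¬ N.After t (Sum.inr s))
    (hp : p ∈ N.pre s) : ¬ N.Le (Sum.inr t) (Sum.inl p) := by
  intro h
  obtain rfl := hN.eq_of_le_of_not_after (h.trans (le_of_mem_pre hp)) hs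
  exact hN.not_lt_of_le h (lt_of_mem_pre_of_le hp (Le.refl _))

/-- If the last known cuts of `t₁` and `t₂` agree outside the postsets, a node after `t₂` that does
not depend on `t₂` is also a node after `t₁` that does not depend on `t₁`. -/
theorem after_of_lkc_sdiff_eq {t₁ t₂ : T} (h : N.lkc t₁ \ N.post t₁ = N.lkc t₂ \ N.post t₂)
    {x : P ⊕ T} (hx : N.After t₂ x) (hx' : ¬ N.Le (Sum.inr t₂) x) :
    N.After t₁ x ∧ ¬ N.Le (Sum.inr t₁) x := by
  -- places of the second cut below `x` are common to both cuts and outside the postsets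
  have key : ∀ c ∈ N.lkc t₂, N.Le (Sum.inl c) x → c ∈ N.lkc t₁ ∧ c ∉ N.post t₁ := by
    intro c hc hcx
    have : c ∈ N.lkc t₁ \ N.post t₁ := h ▸ ⟨hc, fun h' => hx' ((le_of_mem_post h').trans hcx)⟩
    exact this
  have hnle : ∀ y, N.After t₂ y → N.Le y x → ¬ N.Le y (Sum.inr t₁) := by
    intro y hy hyx hyt
    obtain ⟨c, hc, hcy⟩ := After.exists_lkc_le hN hy
    exact not_lkc_le (key c hc (hcy.trans hyx)).1 (hcy.trans hyt)
  have hpast : ∀ s, N.Le (Sum.inr s) x → N.Le (Sum.inr s) (Sum.inr t₂) →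
      ∃ c, c ∈ N.lkc t₁ ∧ c ∉ N.post t₁ ∧ N.Le (Sum.inr s) (Sum.inl c) := by
    intro s hsx hst
    obtain ⟨c, hc, hsc, hcx⟩ := After.exists_lkc_between hN hx hsx hst
    exact ⟨c, (key c hc hcx).1, (key c hc hcx).2, hsc⟩
  have hdich : ∀ y, N.Le y x → N.Le y (Sum.inr t₂) ∨ N.After t₂ y := fun y hyx =>
    or_iff_not_imp_left.2 fun hy => ⟨hy, fun hc => hx.2 (hc.mono hyx (Le.refl _))⟩
  refine ⟨⟨hnle x hx (Le.refl _), ?_⟩, fun htx => ?_⟩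
  · rintro ⟨s, s', hne, ⟨r, hr, hr'⟩, hs, hs'⟩
    have hrx := (le_of_mem_pre hr).trans hs
    have hst : N.Le (Sum.inr s) (Sum.inr t₂) := by
      rcases hdich _ hs with h | h
      · exact h
      · exact absurd ((le_of_mem_pre hr').trans hs')
          (hnle _ (After.of_mem_pre h hr) hrx)
    obtain ⟨c, hc, -, hsc⟩ := hpast s hs hst
    exact hN.no_self_conflict t₁ (conflict_of_mem_pre hne hr hr' (le_of_le_lkc hsc hc) hs')
  · rcases hdich _ htx with h | h
    · obtain ⟨c, hc, hc', htc⟩ := hpast t₁ htx h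
      exact hN.not_le_of_mem_lkc_sdiff hc hc' htc
    · exact hnle _ h htx (Le.refl _)

/-- The part outside the postset of `t` of the cut reached by firing the causes of `t`, `t` itself
and transitions `Y` that can occur after `t` independently of it. -/
theorem cut_union_sdiff_post {Y : Set T}
    (hY : ∀ s ∈ Y, N.After t (Sum.inr s) ∧ ¬ N.Le (Sum.inr t) (Sum.inr s))
    (hX : N.IsPreconfig ({s | N.Le (Sum.inr s) (Sum.inr t)} ∪ Y)) :
    N.cut ({s | N.Le (Sum.inr s) (Sum.inr t)} ∪ Y) \ N.post t =
      {p | (N.After t (Sum.inl p) ∧ ¬ N.Le (Sum.inr t) (Sum.inl p)) ∧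
        (∀ s, p ∈ N.post s → N.After t (Sum.inr s) ∧ ¬ N.Le (Sum.inr t) (Sum.inr s) → s ∈ Y) ∧
        ∀ s ∈ Y, p ∉ N.pre s} := by
  ext p
  constructor
  · rintro ⟨hp, hpt⟩
    refine ⟨⟨after_of_mem_cut hX (.inl (Le.refl _)) hp, fun h => ?_⟩, fun s hs hsa => ?_,
      fun s hs => hp.2 s (.inr hs)⟩
    · obtain ⟨s, hs, hts⟩ := inr_le_inl h
      rcases hp.1 s hs with h' | h'
      · obtain rfl := Sum.inr_injective (hN.le_antisymm hts h')
        exact hpt hs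
      · exact (hY s h').2 hts
    · exact (hp.1 s hs).resolve_left hsa.1.1
  · rintro ⟨⟨hp, htp⟩, hprod, hcons⟩
    refine ⟨⟨fun s hs => ?_, ?_⟩, fun h => htp (le_of_mem_post h)⟩
    · by_cases hc : p ∈ N.lkc t
      · exact .inl (hc.2 s hs)
      · exact .inr (hprod s hs ⟨After.producer hN hp hs hc,
          fun h => htp (h.trans (le_of_mem_post hs))⟩)
    · rintro s (hs | hs) hps
      · exact hp.1 ((le_of_mem_pre hps).trans hs)
      · exact hcons s hs hps

theorem post_subset_cut_union {Y : Set T} (hY : ∀ s ∈ Y, ¬ N.Le (Sum.inr t) (Sum.inr s)) :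
    N.post t ⊆ N.cut ({s | N.Le (Sum.inr s) (Sum.inr t)} ∪ Y) := by
  refine fun p hp => ⟨fun s hs => .inl ?_, ?_⟩
  · rw [hN.producer_unique hs hp]
    exact Le.refl _
  · rintro s (hs | hs) hps
    · exact hN.not_lt_of_le (le_of_mem_post hp) (lt_of_mem_pre_of_le hps hs)
    · exact hY s hs ((le_of_mem_post hp).trans (le_of_mem_pre hps))

/-- Transitions that can occur after `t` independently of it and that are closed among
themselves may follow the causes of `t`. -/
theorem isConfig_union {Y : Set T} (hfin : Y.Finite)
    (hY : ∀ s ∈ Y, N.After t (Sum.inr s) ∧ ¬ N.Le (Sum.inr t) (Sum.inr s))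
    (hclosed : ∀ s ∈ Y, ∀ p ∈ N.pre s, ∀ r, p ∈ N.post r →
      N.After t (Sum.inr r) ∧ ¬ N.Le (Sum.inr t) (Sum.inr r) → r ∈ Y)
    (hdis : ∀ s ∈ Y, ∀ r ∈ Y, ∀ p, p ∈ N.pre s → p ∈ N.pre r → s = r) :
    N.IsConfig ({s | N.Le (Sum.inr s) (Sum.inr t)} ∪ Y) := by
  have hpast := hN.isConfig_le (Sum.inr t)
  refine ⟨⟨?_, ?_⟩, hpast.finite.union hfin⟩
  · rintro s (hs | hs) p hp r hr
    · exact .inl (hpast.closed s hs p hp r hr)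
    · by_cases hc : p ∈ N.lkc t
      · exact .inl (hc.2 r hr)
      · exact .inr (hclosed s hs p hp r hr
          ⟨After.producer hN (After.of_mem_pre (hY s hs).1 hp) hr hc,
            fun h => (hY s hs).2 (h.trans ((le_of_mem_post hr).trans (le_of_mem_pre hp)))⟩)
  · rintro s (hs | hs) r (hr | hr) p hp hp'
    · exact hpast.eq_of_mem_pre s hs r hr p hp hp'
    · exact absurd ((le_of_mem_pre hp).trans hs) (After.of_mem_pre (hY r hr).1 hp').1
    · exact absurd ((le_of_mem_pre hp').trans hr) (After.of_mem_pre (hY s hs).1 hp).1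
    · exact hdis s hs r hr p hp hp'

end IsOccurrenceNet

end Net

/-! ### Copying and renaming of places -/

namespace LabelledNet

variable {P : Type u} {T : Type v} {P₀ : Type u₀} {T₀ : Type v₀}

/-- Two distinct transitions with nonempty postsets whose last known cuts are partial repetition
cuts: the case in which cutting and gluing changes the branching process. -/
structure IsGluePair (σ : LabelledNet P T P₀ T₀) (N₀ : Net P₀ T₀) (t₁ t₂ : T) : Prop where
  isBranchingProc : σ.IsBranchingProc N₀
  isSafe : N₀.IsSafe
  prc : σ.Prc t₁ t₂
  ne : t₁ ≠ t₂
  post₁ : (σ.post t₁).Nonempty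
  post₂ : (σ.post t₂).Nonempty

theorem IsBranchingProc.injOn_lkc {σ : LabelledNet P T P₀ T₀} {N₀ : Net P₀ T₀}
    (hB : σ.IsBranchingProc N₀) (hs : N₀.IsSafe) (t : T) : Set.InjOn σ.πP (σ.lkc t) := by
  rw [Net.lkc_eq_cut]
  exact hB.injOn_cut hs (hB.isOccurrenceNet.isConfig_le (Sum.inr t))

theorem Prc.symm {σ : LabelledNet P T P₀ T₀} {t₁ t₂ : T} (h : σ.Prc t₁ t₂) : σ.Prc t₂ t₁ :=
  ⟨h.1.symm, h.2.symm⟩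

/-- Cutting at the last known cut of `t₂` and gluing the future of that of `t₁`. -/
abbrev glue (σ : LabelledNet P T P₀ T₀) (t₁ t₂ : T) :=
  σ.cutGlue (σ.lkc t₁) (σ.lkc t₂)

namespace IsGluePair

variable {σ : LabelledNet P T P₀ T₀} {N₀ : Net P₀ T₀} {t₁ t₂ : T} (h : σ.IsGluePair N₀ t₁ t₂)
include h

theorem isOccurrenceNet : σ.IsOccurrenceNet := h.isBranchingProc.isOccurrenceNet

theorem symm : σ.IsGluePair N₀ t₂ t₁ :=
  ⟨h.isBranchingProc, h.isSafe, h.prc.symm, h.ne.symm, h.post₂, h.post₁⟩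

theorem mem_futurePlaces {p : P} : p ∈ σ.futurePlaces (σ.lkc t₁) ↔ σ.After t₁ (Sum.inl p) :=
  h.isOccurrenceNet.inFuture_lkc_iff h.post₁

theorem mem_futureTransitions {s : T} :
    s ∈ σ.futureTransitions (σ.lkc t₁) ↔ σ.After t₁ (Sum.inr s) :=
  h.isOccurrenceNet.inFuture_lkc_iff h.post₁

theorem injOn_lkc : Set.InjOn σ.πP (σ.lkc t₁) := h.isBranchingProc.injOn_lkc h.isSafe t₁

/-- The nodes common to both futures that depend on neither transition. -/
theorem common {x : P ⊕ T} (hx : σ.After t₁ x) (hx' : ¬ σ.Le (Sum.inr t₁) x) :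
    σ.After t₂ x ∧ ¬ σ.Le (Sum.inr t₂) x :=
  h.isOccurrenceNet.after_of_lkc_sdiff_eq h.prc.2.symm hx hx'

theorem mem_lkc_of_not_le {c : P} (hc : c ∈ σ.lkc t₁) (hc' : ¬ σ.Le (Sum.inr t₁) (Sum.inl c)) :
    c ∈ σ.lkc t₂ := by
  have : c ∈ σ.lkc t₂ \ σ.post t₂ :=
    h.prc.2 ▸ ⟨hc, fun hp => hc' (Net.le_of_mem_post hp)⟩
  exact this.1

theorem not_le_of_mem_inter {c : P} (hc₁ : c ∈ σ.lkc t₁) (hc₂ : c ∈ σ.lkc t₂) :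
    ¬ σ.Le (Sum.inr t₁) (Sum.inl c) := by
  refine h.isOccurrenceNet.not_le_of_mem_lkc_sdiff hc₁ fun hp => h.ne ?_
  have hp₂ : c ∈ σ.post t₂ := by
    by_contra hp₂
    have : c ∈ σ.lkc t₁ \ σ.post t₁ := h.prc.2 ▸ ⟨hc₂, hp₂⟩
    exact this.2 hp
  exact h.isOccurrenceNet.producer_unique hp hp₂

theorem exists_mate {c : P} (hc : c ∈ σ.lkc t₁) : ∃ c' ∈ σ.lkc t₂, σ.πP c' = σ.πP c := by
  have : σ.πP c ∈ σ.lkm t₂ := h.prc.1 ▸ ⟨c, hc, rfl⟩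
  exact this

/-- Equally labelled places of the two cuts coincide if one of them lies outside the postsets. -/
theorem mate_eq_of_not_le {c c' : P} (hc : c ∈ σ.lkc t₁) (hc' : c' ∈ σ.lkc t₂)
    (hl : σ.πP c' = σ.πP c) (hn : ¬ σ.Le (Sum.inr t₁) (Sum.inl c)) : c' = c :=
  h.symm.injOn_lkc hc' (h.mem_lkc_of_not_le hc hn) hl

/-- Renaming is total on the places that do not depend on `t₂`, and on those outside the future. -/
theorem rename_total {p : P} (hp : σ.After t₂ (Sum.inl p) → ¬ σ.Le (Sum.inr t₂) (Sum.inl p)) :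
    ∃ q, σ.Rename (σ.lkc t₁) (σ.lkc t₂) p q := by
  by_cases hf : p ∈ σ.futurePlaces (σ.lkc t₂) \ σ.lkc t₂
  · have hp₂ := h.symm.mem_futurePlaces.1 hf.1
    have hp₁ := h.symm.common hp₂ (hp hp₂)
    refine ⟨Sum.inr ⟨p, h.mem_futurePlaces.2 hp₁.1, fun hc => ?_⟩, rfl, hf, fun c hc hcp => ?_⟩
    · exact hf.2 (h.mem_lkc_of_not_le hc hp₁.2)
    · exact h.symm.mem_lkc_of_not_le hc fun hle => hp hp₂ (hle.trans hcp)
  · exact ⟨Sum.inl ⟨p, hf⟩, rfl⟩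

omit h in
theorem rename_right_unique {p : P} {q q' : σ.GluePlace (σ.lkc t₁) (σ.lkc t₂)}
    (hq : σ.Rename (σ.lkc t₁) (σ.lkc t₂) p q) (hq' : σ.Rename (σ.lkc t₁) (σ.lkc t₂) p q') :
    q = q' := by
  rcases q with q | q <;> rcases q' with q' | q'
  · exact congrArg Sum.inl (Subtype.ext (Eq.trans hq (Eq.symm hq')))
  · exact absurd hq'.2.1 (hq ▸ q.2)
  · exact absurd hq.2.1 (hq' ▸ q'.2)
  · exact congrArg Sum.inr (Subtype.ext (hq.1.trans hq'.1.symm))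

omit h in
theorem rename_left_unique (p p' : P) (q : σ.GluePlace (σ.lkc t₁) (σ.lkc t₂))
    (hq : σ.Rename (σ.lkc t₁) (σ.lkc t₂) p q) (hq' : σ.Rename (σ.lkc t₁) (σ.lkc t₂) p' q) :
    p = p' := by
  rcases q with q | q
  · exact Eq.trans (Eq.symm hq) hq'
  · exact hq.1.symm.trans hq'.1

omit h in
theorem rename_label (p : P) (q : σ.GluePlace (σ.lkc t₁) (σ.lkc t₂))
    (hq : σ.Rename (σ.lkc t₁) (σ.lkc t₂) p q) : (σ.glue t₁ t₂).πP q = σ.πP p := by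
  rcases q with q | q
  · exact congrArg σ.πP hq
  · exact congrArg σ.πP hq.1

theorem after_of_copy {p : P} {q : σ.GluePlace (σ.lkc t₁) (σ.lkc t₂)}
    (hq : σ.Copy (σ.lkc t₁) (σ.lkc t₂) p q) : σ.After t₁ (Sum.inl p) := by
  rcases q with q | q
  · exact h.isOccurrenceNet.after_of_mem_lkc hq.1
  · obtain rfl : q.1 = p := hq
    exact h.mem_futurePlaces.1 q.2.1

theorem copy_total {p : P} (hp : σ.After t₁ (Sum.inl p)) :
    ∃ q, σ.Copy (σ.lkc t₁) (σ.lkc t₂) p q := by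
  by_cases hc : p ∈ σ.lkc t₁
  · obtain ⟨c, hc', hl⟩ := h.exists_mate hc
    exact ⟨Sum.inl ⟨c, fun hf => hf.2 hc'⟩, hc, hc', hl⟩
  · exact ⟨Sum.inr ⟨p, h.mem_futurePlaces.2 hp, hc⟩, rfl⟩

theorem copy_right_unique {p : P} {q q' : σ.GluePlace (σ.lkc t₁) (σ.lkc t₂)}
    (hq : σ.Copy (σ.lkc t₁) (σ.lkc t₂) p q) (hq' : σ.Copy (σ.lkc t₁) (σ.lkc t₂) p q') :
    q = q' := by
  rcases q with q | q <;> rcases q' with q' | q'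
  · exact congrArg Sum.inl (Subtype.ext
      (h.symm.injOn_lkc hq.2.1 hq'.2.1 (hq.2.2.trans hq'.2.2.symm)))
  · obtain rfl : q'.1 = p := hq'
    exact absurd hq.1 q'.2.2
  · obtain rfl : q.1 = p := hq
    exact absurd hq'.1 q.2.2
  · exact congrArg Sum.inr (Subtype.ext (Eq.trans hq (Eq.symm hq')))

theorem copy_left_unique (p p' : P) (q : σ.GluePlace (σ.lkc t₁) (σ.lkc t₂))
    (hq : σ.Copy (σ.lkc t₁) (σ.lkc t₂) p q) (hq' : σ.Copy (σ.lkc t₁) (σ.lkc t₂) p' q) :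
    p = p' := by
  rcases q with q | q
  · exact h.injOn_lkc hq.1 hq'.1 (hq.2.2.symm.trans hq'.2.2)
  · exact Eq.trans (Eq.symm hq) hq'

omit h in
theorem copy_label (p : P) (q : σ.GluePlace (σ.lkc t₁) (σ.lkc t₂))
    (hq : σ.Copy (σ.lkc t₁) (σ.lkc t₂) p q) : (σ.glue t₁ t₂).πP q = σ.πP p := by
  rcases q with q | q
  · exact hq.2.2
  · exact congrArg σ.πP hq

/-- A node of the glued process that is both the copy of `p'` and the renamed place `p` belongs
to the common part, provided that `p` does not depend on `t₂`. -/
theorem eq_of_copy_of_rename {p p' : P} {q : σ.GluePlace (σ.lkc t₁) (σ.lkc t₂)}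
    (hq' : σ.Copy (σ.lkc t₁) (σ.lkc t₂) p' q) (hq : σ.Rename (σ.lkc t₁) (σ.lkc t₂) p q)
    (hp : ¬ σ.Le (Sum.inr t₂) (Sum.inl p)) :
    p' = p ∧ ¬ σ.Le (Sum.inr t₁) (Sum.inl p') := by
  rcases q with q | q
  · obtain rfl : q.1 = p := hq
    obtain ⟨hc, hc', hl⟩ := hq'
    have := h.symm.mate_eq_of_not_le hc' hc hl.symm hp
    exact ⟨this, h.not_le_of_mem_inter hc (this ▸ hc')⟩
  · obtain rfl : q.1 = p' := hq'
    obtain ⟨rfl, hf, -⟩ := hq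
    exact ⟨rfl, (h.symm.common (h.symm.mem_futurePlaces.1 hf.1) hp).2⟩

/-- On the common part of the two futures, copying and renaming agree. -/
theorem copy_iff_rename {p : P} (hp : σ.After t₁ (Sum.inl p))
    (hn : ¬ σ.Le (Sum.inr t₁) (Sum.inl p)) (q : σ.GluePlace (σ.lkc t₁) (σ.lkc t₂)) :
    σ.Copy (σ.lkc t₁) (σ.lkc t₂) p q ↔ σ.Rename (σ.lkc t₁) (σ.lkc t₂) p q := by
  have hp₂ := h.common hp hn
  obtain ⟨q₁, hq₁⟩ := h.copy_total hp
  obtain ⟨q₂, hq₂⟩ := h.rename_total fun _ => hp₂.2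
  have heq : q₁ = q₂ := by
    rcases q₁ with q₁ | q₁
    · refine rename_right_unique (q := Sum.inl q₁) ?_ hq₂
      exact h.mate_eq_of_not_le hq₁.1 hq₁.2.1 hq₁.2.2 hn
    · obtain rfl : q₁.1 = p := hq₁
      rcases q₂ with q₂ | q₂
      · have hq₂' : q₂.1 = q₁.1 := hq₂
        refine absurd ⟨h.symm.mem_futurePlaces.2 hp₂.1, fun hc => ?_⟩ (hq₂' ▸ q₂.2)
        exact q₁.2.2 (h.symm.mem_lkc_of_not_le hc hp₂.2)
      · exact congrArg Sum.inr (Subtype.ext hq₂.1.symm)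
  subst heq
  exact ⟨fun hq => h.copy_right_unique hq₁ hq ▸ hq₂, fun hq => rename_right_unique hq₂ hq ▸ hq₁⟩

/-! ### The glued process is a branching process -/

theorem after_kept {s : T} (hs : s ∉ σ.futureTransitions (σ.lkc t₂)) :
    ¬ σ.After t₂ (Sum.inr s) := fun ha => hs (h.symm.mem_futureTransitions.2 ha)

theorem rename_total_pre {s : T} (hs : s ∉ σ.futureTransitions (σ.lkc t₂)) {p : P}
    (hp : p ∈ σ.pre s) : ∃ q, σ.Rename (σ.lkc t₁) (σ.lkc t₂) p q :=
  h.rename_total fun _ =>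
    h.isOccurrenceNet.not_le_of_mem_pre_of_not_after (h.after_kept hs) hp

theorem notMem_of_mem_post {s : T} (hs : s ∉ σ.futureTransitions (σ.lkc t₂)) {p : P}
    (hp : p ∈ σ.post s) : p ∉ σ.futurePlaces (σ.lkc t₂) \ σ.lkc t₂ := fun hf =>
  h.after_kept hs ((h.symm.mem_futurePlaces.1 hf.1).producer h.isOccurrenceNet hp hf.2)

/-- The places produced by a kept transition are kept. -/
theorem rename_post_iff {s : T} (hs : s ∉ σ.futureTransitions (σ.lkc t₂)) {p : P}
    (hp : p ∈ σ.post s) {q : σ.GluePlace (σ.lkc t₁) (σ.lkc t₂)} :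
    σ.Rename (σ.lkc t₁) (σ.lkc t₂) p q ↔ q = Sum.inl ⟨p, h.notMem_of_mem_post hs hp⟩ := by
  refine ⟨fun hq => rename_right_unique hq (q' := Sum.inl ⟨p, _⟩) rfl, ?_⟩
  rintro rfl
  rfl

theorem notMem_of_mem_init {p : P} (hp : p ∈ σ.init) :
    p ∉ σ.futurePlaces (σ.lkc t₂) \ σ.lkc t₂ := fun hf => by
  obtain ⟨s, hs⟩ := (h.symm.mem_futurePlaces.1 hf.1).exists_producer hf.2
  rw [h.isOccurrenceNet.init_eq] at hp
  have : s ∈ ({t | p ∈ σ.post t} : Set T) := hs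
  rw [show {t | p ∈ σ.post t} = ∅ from hp] at this
  exact this

theorem rename_init_iff {p : P} (hp : p ∈ σ.init) {q : σ.GluePlace (σ.lkc t₁) (σ.lkc t₂)} :
    σ.Rename (σ.lkc t₁) (σ.lkc t₂) p q ↔ q = Sum.inl ⟨p, h.notMem_of_mem_init hp⟩ := by
  refine ⟨fun hq => rename_right_unique hq (q' := Sum.inl ⟨p, _⟩) rfl, ?_⟩
  rintro rfl
  rfl

/-- The places produced by a copied transition are copies outside the cut. -/
theorem copy_post_iff {s : T} (hs : s ∈ σ.futureTransitions (σ.lkc t₁)) {p : P}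
    (hp : p ∈ σ.post s) {q : σ.GluePlace (σ.lkc t₁) (σ.lkc t₂)} :
    σ.Copy (σ.lkc t₁) (σ.lkc t₂) p q ↔ ∃ q', q = Sum.inr q' ∧ q'.1 = p := by
  have hc := (h.mem_futureTransitions.1 hs).notMem_lkc hp
  rcases q with q | q
  · exact ⟨fun hq => absurd hq.1 hc, by rintro ⟨_, hq, -⟩; cases hq⟩
  · exact ⟨fun hq => ⟨q, rfl, hq⟩, by rintro ⟨_, hq, hq'⟩; cases hq; exact hq'⟩

theorem mem_post_inl_iff {s : {t : T // t ∉ σ.futureTransitions (σ.lkc t₂)}}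
    {q : σ.GluePlace (σ.lkc t₁) (σ.lkc t₂)} :
    q ∈ (σ.glue t₁ t₂).post (Sum.inl s) ↔ ∃ q', q = Sum.inl q' ∧ q'.1 ∈ σ.post s.1 := by
  constructor
  · rintro ⟨p, hp, hq⟩
    exact ⟨_, (h.rename_post_iff s.2 hp).1 hq, hp⟩
  · rintro ⟨q', rfl, hq⟩
    exact ⟨_, hq, rfl⟩

theorem mem_post_inr_iff {s : {t : T // t ∈ σ.futureTransitions (σ.lkc t₁)}}
    {q : σ.GluePlace (σ.lkc t₁) (σ.lkc t₂)} :
    q ∈ (σ.glue t₁ t₂).post (Sum.inr s) ↔ ∃ q', q = Sum.inr q' ∧ q'.1 ∈ σ.post s.1 := by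
  constructor
  · rintro ⟨p, hp, hq⟩
    obtain ⟨q', rfl, rfl⟩ := (h.copy_post_iff s.2 hp).1 hq
    exact ⟨q', rfl, hp⟩
  · rintro ⟨q', rfl, hq⟩
    exact ⟨_, hq, rfl⟩

theorem copy_total_pre {s : T} (hs : s ∈ σ.futureTransitions (σ.lkc t₁)) {p : P}
    (hp : p ∈ σ.pre s) : ∃ q, σ.Copy (σ.lkc t₁) (σ.lkc t₂) p q :=
  h.copy_total ((h.mem_futureTransitions.1 hs).of_mem_pre hp)

theorem isHom : (σ.glue t₁ t₂).IsHom N₀ where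
  pre_bijOn := by
    rintro (s | s)
    · exact bijOn_relImage (h.isBranchingProc.isHom.pre_bijOn s.1)
        (fun p hp => h.rename_total_pre s.2 hp) (fun _ _ _ => rename_right_unique) rename_label
    · exact bijOn_relImage (h.isBranchingProc.isHom.pre_bijOn s.1)
        (fun p hp => h.copy_total_pre s.2 hp) (fun _ _ _ => h.copy_right_unique) copy_label
  post_bijOn := by
    rintro (s | s)
    · exact bijOn_relImage (h.isBranchingProc.isHom.post_bijOn s.1)
        (fun p hp => ⟨_, (h.rename_post_iff s.2 hp).2 rfl⟩) (fun _ _ _ => rename_right_unique)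
        rename_label
    · exact bijOn_relImage (h.isBranchingProc.isHom.post_bijOn s.1)
        (fun p hp => h.copy_total
          ((h.mem_futureTransitions.1 s.2).of_mem_post h.isOccurrenceNet hp))
        (fun _ _ _ => h.copy_right_unique) copy_label
  init_bijOn := bijOn_relImage h.isBranchingProc.isHom.init_bijOn
    (fun p hp => ⟨_, (h.rename_init_iff hp).2 rfl⟩) (fun _ _ _ => rename_right_unique)
    rename_label

/-- A kept transition consumes a place outside the future, hence no copied transition has the
same preset. -/
theorem exists_mem_pre_inl {s : T} (hs : s ∉ σ.futureTransitions (σ.lkc t₂)) :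
    ∃ p ∈ σ.pre s, ¬ σ.After t₂ (Sum.inl p) := by
  by_contra! hall
  exact h.after_kept hs (h.isOccurrenceNet.after_of_forall_mem_pre hall)

theorem not_relImage_subset {s : T} (hs : s ∉ σ.futureTransitions (σ.lkc t₂)) {S : Set P} :
    ¬ relImage (σ.Rename (σ.lkc t₁) (σ.lkc t₂)) (σ.pre s) ⊆
      relImage (σ.Copy (σ.lkc t₁) (σ.lkc t₂)) S := by
  intro hsub
  obtain ⟨p, hp, hpa⟩ := h.exists_mem_pre_inl hs
  have hkept : p ∉ σ.futurePlaces (σ.lkc t₂) \ σ.lkc t₂ := fun hf =>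
    hpa (h.symm.mem_futurePlaces.1 hf.1)
  obtain ⟨p', -, hc⟩ := @hsub (Sum.inl ⟨p, hkept⟩) ⟨p, hp, rfl⟩
  exact hpa (h.isOccurrenceNet.after_of_mem_lkc hc.2.1)

theorem eq_of_pre_eq (s s' : σ.GlueTransition (σ.lkc t₁) (σ.lkc t₂))
    (hpre : (σ.glue t₁ t₂).pre s = (σ.glue t₁ t₂).pre s')
    (hl : (σ.glue t₁ t₂).πT s = (σ.glue t₁ t₂).πT s') : s = s' := by
  rcases s with s | s <;> rcases s' with s' | s'
  · refine congrArg Sum.inl (Subtype.ext (h.isBranchingProc.eq_of_pre_eq _ _ ?_ hl))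
    exact (subset_of_relImage_subset rename_left_unique
      (fun p hp => h.rename_total_pre s.2 hp) hpre.subset).antisymm
      (subset_of_relImage_subset rename_left_unique
      (fun p hp => h.rename_total_pre s'.2 hp) hpre.superset)
  · exact absurd hpre.subset (h.not_relImage_subset s.2)
  · exact absurd hpre.superset (h.not_relImage_subset s'.2)
  · refine congrArg Sum.inr (Subtype.ext (h.isBranchingProc.eq_of_pre_eq _ _ ?_ hl))
    exact (subset_of_relImage_subset h.copy_left_unique
      (fun p hp => h.copy_total_pre s.2 hp) hpre.subset).antisymm
      (subset_of_relImage_subset h.copy_left_unique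
      (fun p hp => h.copy_total_pre s'.2 hp) hpre.superset)

end IsGluePair

end LabelledNet

namespace Net

variable {P : Type u} {T : Type v} {N : Net P T}

/-! ### Nets with a well-founded measure -/

theorem acyclic_of_measure {α : Type*} [Preorder α] (μ : P ⊕ T → α)
    (hμ : ∀ x y, N.Flow x y → μ x < μ y) (x : P ⊕ T) : ¬ N.Lt x x := by
  have key : ∀ y, N.Lt x y → μ x < μ y := by
    intro y hy
    induction hy with
    | single h => exact hμ _ _ h
    | tail _ h ih => exact ih.trans (hμ _ _ h)
  exact fun h => lt_irrefl _ (key x h)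

theorem finitely_preceded_of_measure {α : Type*} [Preorder α] [WellFoundedLT α] (μ : P ⊕ T → α)
    (hμ : ∀ x y, N.Flow x y → μ x < μ y) (hpre : ∀ t, (N.pre t).Finite)
    (hprod : ∀ p, {t | p ∈ N.post t}.Subsingleton) (x : P ⊕ T) : {y | N.Le y x}.Finite := by
  induction h : μ x using WellFoundedLT.induction generalizing x with
  | _ a ih =>
    subst h
    have hflow : {z | N.Flow z x}.Finite := by
      rcases x with p | t
      · refine ((hprod p).finite.image Sum.inr).subset ?_
        rintro (q | s) hz
        exacts [hz.elim, ⟨s, hz, rfl⟩]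
      · refine ((hpre t).image Sum.inl).subset ?_
        rintro (q | s) hz
        exacts [⟨q, hz, rfl⟩, hz.elim]
    refine ((hflow.biUnion fun z hz => ih _ (hμ z x hz) z rfl).insert x).subset fun y hy => ?_
    rcases Relation.ReflTransGen.cases_tail hy with h | ⟨z, hyz, hz⟩
    · exact .inl h.symm
    · exact .inr (Set.mem_biUnion (x := z) hz hyz)

/-! ### Futures of arbitrary sets of places -/

theorem InFuture.of_mem_pre (hN : N.IsOccurrenceNet) {C : Set P} {t : T} {p : P}
    (ht : N.InFuture C (Sum.inr t)) (hp : p ∈ N.pre t) : N.InFuture C (Sum.inl p) := by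
  intro c hc
  by_cases hcp : N.Le (Sum.inl c) (Sum.inl p)
  · exact .inl hcp
  have hpt := le_of_mem_pre hp
  have hconf : ¬ N.Conflict (Sum.inl c) (Sum.inr t) := fun h => by
    rcases ht c hc with h' | h'
    · exact hN.not_conflict_self _ (h.mono h' (Le.refl _))
    · exact h'.2.2 h
  refine .inr ⟨hcp, fun hpc => ?_, fun h => hconf (h.mono (Le.refl _) hpt)⟩
  rcases inl_le_cases hpc with h | ⟨s, hs, hsc⟩
  · exact hcp (h ▸ Le.refl _)
  by_cases hst : s = t
  · subst hst
    rcases ht c hc with h' | h'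
    · exact absurd (hN.le_antisymm hsc h') (by simp)
    · exact h'.2.1 hsc
  · exact hconf (conflict_of_mem_pre hst hs hp hsc (Le.refl _))

theorem InFuture.of_mem_post (hN : N.IsOccurrenceNet) {C : Set P} {t : T} {p : P}
    (ht : N.InFuture C (Sum.inr t)) (hp : p ∈ N.post t) : N.InFuture C (Sum.inl p) := by
  intro c hc
  have htp := le_of_mem_post hp
  rcases ht c hc with h | h
  · exact .inl (h.trans htp)
  by_cases hcp : N.Le (Sum.inl c) (Sum.inl p)
  · exact .inl hcp
  exact .inr ⟨hcp, fun hpc => h.2.1 (htp.trans hpc),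
    fun hcf => h.2.2 (hN.conflict_producer hcf.symm hp).symm⟩

end Net

namespace LabelledNet

variable {P : Type u} {T : Type v} {P₀ : Type u₀} {T₀ : Type v₀}

/-- Replacing a future by its own copy yields an isomorphic process. -/
theorem IsWinning.cutGlue_self {σ : LabelledNet P T P₀ T₀} {G : PetriGame P₀ T₀}
    (hσ : σ.IsWinning G) {C : Set P} (hC : Set.InjOn σ.πP C) : (σ.cutGlue C C).IsWinning G := by
  have hN := hσ.isBranchingProc.isOccurrenceNet
  have hrename : ∀ p q, σ.Rename C C p q ↔ Sum.elim Subtype.val Subtype.val q = p := by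
    rintro p (q | q)
    · exact Iff.rfl
    · refine ⟨fun h => h.1, ?_⟩
      rintro rfl
      exact ⟨rfl, q.2, fun c hc _ => hc⟩
  have hcopy : ∀ p q, p ∈ σ.futurePlaces C →
      (σ.Copy C C p q ↔ Sum.elim Subtype.val Subtype.val q = p) := by
    rintro p (q | q) hp
    · refine ⟨fun h => hC h.2.1 h.1 h.2.2, ?_⟩
      rintro rfl
      have hqC : q.1 ∈ C := by_contra fun hqC => q.2 ⟨hp, hqC⟩
      exact ⟨hqC, hqC, rfl⟩
    · exact Iff.rfl
  refine hσ.of_bijective (f := Sum.elim Subtype.val Subtype.val)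
    (g := Sum.elim Subtype.val Subtype.val) ?_ ?_ ?_ ?_ ?_ ?_ ?_
  · refine ⟨Function.Injective.sumElim Subtype.val_injective Subtype.val_injective
      fun a b hab => a.2 (hab ▸ b.2), fun p => ?_⟩
    by_cases hp : p ∈ σ.futurePlaces C \ C
    exacts [⟨Sum.inr ⟨p, hp⟩, rfl⟩, ⟨Sum.inl ⟨p, hp⟩, rfl⟩]
  · refine ⟨Function.Injective.sumElim Subtype.val_injective Subtype.val_injective
      fun a b hab => a.2 (hab ▸ b.2), fun p => ?_⟩
    by_cases hp : p ∈ σ.futureTransitions C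
    exacts [⟨Sum.inr ⟨p, hp⟩, rfl⟩, ⟨Sum.inl ⟨p, hp⟩, rfl⟩]
  · rintro (t | t) q
    · exact ⟨fun ⟨p, hp, hq⟩ => (hrename p q).1 hq ▸ hp, fun hq => ⟨_, hq, (hrename _ q).2 rfl⟩⟩
    · exact ⟨fun ⟨p, hp, hq⟩ => (hcopy p q (t.2.of_mem_pre hN hp)).1 hq ▸ hp,
        fun hq => ⟨_, hq, (hcopy _ q (t.2.of_mem_pre hN hq)).2 rfl⟩⟩
  · rintro (t | t) q
    · exact ⟨fun ⟨p, hp, hq⟩ => (hrename p q).1 hq ▸ hp, fun hq => ⟨_, hq, (hrename _ q).2 rfl⟩⟩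
    · exact ⟨fun ⟨p, hp, hq⟩ => (hcopy p q (t.2.of_mem_post hN hp)).1 hq ▸ hp,
        fun hq => ⟨_, hq, (hcopy _ q (t.2.of_mem_post hN hq)).2 rfl⟩⟩
  · intro q
    exact ⟨fun ⟨p, hp, hq⟩ => (hrename p q).1 hq ▸ hp, fun hq => ⟨_, hq, (hrename _ q).2 rfl⟩⟩
  · rintro (q | q) <;> rfl
  · rintro (t | t) <;> rfl

namespace IsGluePair

variable {σ : LabelledNet P T P₀ T₀} {N₀ : Net P₀ T₀} {t₁ t₂ : T} (h : σ.IsGluePair N₀ t₁ t₂)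

/-! ### The glued process is an occurrence net -/

open Classical in
/-- A measure that increases along the flow of the glued process: first whether the node is a copy
that depends on `t₁`, then the rank of the original node. The first component takes care of the
arcs from places produced by `t₂` to copies, which have no counterpart in `σ`. -/
noncomputable def measure (σ : LabelledNet P T P₀ T₀) (t₁ t₂ : T) :
    σ.GluePlace (σ.lkc t₁) (σ.lkc t₂) ⊕ σ.GlueTransition (σ.lkc t₁) (σ.lkc t₂) → ℕ ×ₗ ℕ
  | Sum.inl (Sum.inl p) => toLex (0, Net.rank σ.toNet (Sum.inl p.1))
  | Sum.inl (Sum.inr p) =>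
      toLex (if σ.Le (Sum.inr t₁) (Sum.inl p.1) then 1 else 0, Net.rank σ.toNet (Sum.inl p.1))
  | Sum.inr (Sum.inl s) => toLex (0, Net.rank σ.toNet (Sum.inr s.1))
  | Sum.inr (Sum.inr s) =>
      toLex (if σ.Le (Sum.inr t₁) (Sum.inr s.1) then 1 else 0, Net.rank σ.toNet (Sum.inr s.1))

include h

theorem measure_lt (x y) (hxy : (σ.glue t₁ t₂).Flow x y) :
    measure σ t₁ t₂ x < measure σ t₁ t₂ y := by
  have hN := h.isOccurrenceNet
  have hpre : ∀ {p s}, p ∈ σ.pre s →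
      Net.rank σ.toNet (Sum.inl p) < Net.rank σ.toNet (Sum.inr s) :=
    fun {p s} hp => hN.rank_lt_rank (x := Sum.inl p) (y := Sum.inr s) hp
  have hpost : ∀ {p s}, p ∈ σ.post s →
      Net.rank σ.toNet (Sum.inr s) < Net.rank σ.toNet (Sum.inl p) :=
    fun {p s} hp => hN.rank_lt_rank (x := Sum.inr s) (y := Sum.inl p) hp
  rcases x with q | s <;> rcases y with q' | s'
  · exact hxy.elim
  · rcases s' with s | s
    · obtain ⟨p, hp, hq⟩ := hxy
      have hr := hpre hp
      rcases q with q | q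
      · obtain rfl : q.1 = p := hq
        simpa [measure, Prod.Lex.toLex_lt_toLex] using hr
      · obtain ⟨rfl, hf, -⟩ := hq
        have hn := (h.symm.common (h.symm.mem_futurePlaces.1 hf.1)
          (hN.not_le_of_mem_pre_of_not_after (h.after_kept s.2) hp)).2
        simpa [measure, Prod.Lex.toLex_lt_toLex, hn] using hr
    · obtain ⟨p, hp, hq⟩ := hxy
      have hr := hpre hp
      by_cases hs : σ.Le (Sum.inr t₁) (Sum.inr s.1)
      · rcases q with q | q
        · simp [measure, Prod.Lex.toLex_lt_toLex, hs]
        · obtain rfl : q.1 = p := hq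
          by_cases hq : σ.Le (Sum.inr t₁) (Sum.inl q.1)
          · simpa [measure, Prod.Lex.toLex_lt_toLex, hs, hq] using hr
          · simp [measure, Prod.Lex.toLex_lt_toLex, hs, hq]
      · have hn : ¬ σ.Le (Sum.inr t₁) (Sum.inl p) := fun hp' =>
          hs (hp'.trans (Net.le_of_mem_pre hp))
        rcases q with q | q
        · obtain rfl := h.mate_eq_of_not_le hq.1 hq.2.1 hq.2.2 hn
          simpa [measure, Prod.Lex.toLex_lt_toLex, hs] using hr
        · obtain rfl : q.1 = p := hq
          simpa [measure, Prod.Lex.toLex_lt_toLex, hs, hn] using hr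
  · rcases s with s | s
    · obtain ⟨q, rfl, hq⟩ := h.mem_post_inl_iff.1 hxy
      simpa [measure, Prod.Lex.toLex_lt_toLex] using hpost hq
    · obtain ⟨q, rfl, hq⟩ := h.mem_post_inr_iff.1 hxy
      have hiff : σ.Le (Sum.inr t₁) (Sum.inl q.1) ↔ σ.Le (Sum.inr t₁) (Sum.inr s.1) :=
        ⟨fun hle => hN.le_producer hle hq, fun hle => hle.trans (Net.le_of_mem_post hq)⟩
      by_cases hle : σ.Le (Sum.inr t₁) (Sum.inr s.1)
      · simpa [measure, Prod.Lex.toLex_lt_toLex, hle, hiff.2 hle] using hpost hq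
      · simpa [measure, Prod.Lex.toLex_lt_toLex, hle, mt hiff.1 hle] using hpost hq
  · exact hxy.elim

theorem producer_unique {q : σ.GluePlace (σ.lkc t₁) (σ.lkc t₂)}
    {s s' : σ.GlueTransition (σ.lkc t₁) (σ.lkc t₂)} (hs : q ∈ (σ.glue t₁ t₂).post s)
    (hs' : q ∈ (σ.glue t₁ t₂).post s') : s = s' := by
  have hN := h.isOccurrenceNet
  rcases s with s | s <;> rcases s' with s' | s'
  · obtain ⟨q₁, rfl, hq₁⟩ := h.mem_post_inl_iff.1 hs
    obtain ⟨q₂, hq, hq₂⟩ := h.mem_post_inl_iff.1 hs'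
    cases hq
    exact congrArg Sum.inl (Subtype.ext (hN.producer_unique hq₁ hq₂))
  · obtain ⟨q₁, rfl, hq₁⟩ := h.mem_post_inl_iff.1 hs
    obtain ⟨q₂, hq, hq₂⟩ := h.mem_post_inr_iff.1 hs'
    cases hq
  · obtain ⟨q₁, rfl, hq₁⟩ := h.mem_post_inr_iff.1 hs
    obtain ⟨q₂, hq, hq₂⟩ := h.mem_post_inl_iff.1 hs'
    cases hq
  · obtain ⟨q₁, rfl, hq₁⟩ := h.mem_post_inr_iff.1 hs
    obtain ⟨q₂, hq, hq₂⟩ := h.mem_post_inr_iff.1 hs'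
    cases hq
    exact congrArg Sum.inr (Subtype.ext (hN.producer_unique hq₁ hq₂))

/-- A conflict-free set containing the causes of a kept transition `t₀` in the glued process: kept
causes of `t₀`, and copies of causes of `t₀` that do not depend on `t₁`. -/
theorem isPreconfig_kept (t₀ : T) : (σ.glue t₁ t₂).IsPreconfig
    {s' | Sum.elim (fun s => σ.Le (Sum.inr s.1) (Sum.inr t₀))
      (fun s => σ.Le (Sum.inr s.1) (Sum.inr t₀) ∧ ¬ σ.Le (Sum.inr t₁) (Sum.inr s.1)) s'} := by
  have hN := h.isOccurrenceNet
  -- next to these transitions, copies of places are renamed places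
  have key : ∀ s' ∈ {s' | Sum.elim (fun s : {t : T // t ∉ σ.futureTransitions (σ.lkc t₂)} =>
        σ.Le (Sum.inr s.1) (Sum.inr t₀))
      (fun s : {t : T // t ∈ σ.futureTransitions (σ.lkc t₁)} =>
        σ.Le (Sum.inr s.1) (Sum.inr t₀) ∧ ¬ σ.Le (Sum.inr t₁) (Sum.inr s.1)) s'},
      ∀ q ∈ (σ.glue t₁ t₂).pre s', ∃ p ∈ σ.pre (Sum.elim Subtype.val Subtype.val s'),
        σ.Rename (σ.lkc t₁) (σ.lkc t₂) p q ∧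
        σ.Le (Sum.inr (Sum.elim Subtype.val Subtype.val s')) (Sum.inr t₀) ∧
        (σ.After t₂ (Sum.inl p) → ¬ σ.Le (Sum.inr t₂) (Sum.inl p)) := by
    rintro (s | s) hs q ⟨p, hp, hq⟩
    · exact ⟨p, hp, hq, hs, fun _ => hN.not_le_of_mem_pre_of_not_after (h.after_kept s.2) hp⟩
    · have hn : ¬ σ.Le (Sum.inr t₁) (Sum.inl p) := fun hle =>
        hs.2 (hle.trans (Net.le_of_mem_pre hp))
      have hpa := h.after_of_copy hq
      exact ⟨p, hp, (h.copy_iff_rename hpa hn q).1 hq, hs.1, fun _ => (h.common hpa hn).2⟩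
  constructor
  · intro s' hs' q hq r' hr'
    obtain ⟨p, hp, hpq, hle, hpn⟩ := key s' hs' q hq
    rcases r' with r | r
    · obtain ⟨q, rfl, hqr⟩ := h.mem_post_inl_iff.1 hr'
      obtain rfl : q.1 = p := hpq
      exact ((Net.le_of_mem_post hqr).trans (Net.le_of_mem_pre hp)).trans hle
    · obtain ⟨q, rfl, hqr⟩ := h.mem_post_inr_iff.1 hr'
      obtain ⟨rfl, hf, -⟩ := hpq
      have hpa := h.symm.mem_futurePlaces.1 hf.1
      exact ⟨((Net.le_of_mem_post hqr).trans (Net.le_of_mem_pre hp)).trans hle,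
        fun hle' => (h.symm.common hpa (hpn hpa)).2 (hle'.trans (Net.le_of_mem_post hqr))⟩
  · intro s' hs' r' hr' q hqs hqr
    obtain ⟨p, hp, hpq, hle, -⟩ := key s' hs' q hqs
    obtain ⟨p', hp', hpq', hle', -⟩ := key r' hr' q hqr
    obtain rfl := rename_left_unique p p' q hpq hpq'
    have heq := (hN.isConfig_le (Sum.inr t₀)).eq_of_mem_pre _ hle _ hle' p hp hp'
    rcases s' with s | s <;> rcases r' with r | r
    · exact congrArg Sum.inl (Subtype.ext heq)
    · have heq' : s.1 = r.1 := heq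
      exact absurd (h.common (h.mem_futureTransitions.1 r.2) hr'.2).1
        (heq' ▸ h.after_kept s.2)
    · have heq' : s.1 = r.1 := heq
      exact absurd (h.common (h.mem_futureTransitions.1 s.2) hs'.2).1
        (heq' ▸ h.after_kept r.2)
    · exact congrArg Sum.inr (Subtype.ext heq)

/-- A conflict-free set containing the causes of the copy of `t₀` in the glued process: the causes
of `t₂`, and copies of causes of `t₀`. -/
theorem isPreconfig_copy (t₀ : T) : (σ.glue t₁ t₂).IsPreconfig
    {s' | Sum.elim (fun s => σ.Le (Sum.inr s.1) (Sum.inr t₂))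
      (fun s => σ.Le (Sum.inr s.1) (Sum.inr t₀)) s'} := by
  have hN := h.isOccurrenceNet
  have hkept : ∀ (s : T) (p : P) (q : {p : P // p ∈ σ.futurePlaces (σ.lkc t₁) \ σ.lkc t₁}),
      p ∈ σ.pre s → σ.Le (Sum.inr s) (Sum.inr t₂) →
      ¬ σ.Rename (σ.lkc t₁) (σ.lkc t₂) p (Sum.inr q) := fun s p q hp hs hq =>
    (h.symm.mem_futurePlaces.1 hq.2.1.1).1 ((Net.le_of_mem_pre hp).trans hs)
  have hmixed : ∀ (s : {t : T // t ∉ σ.futureTransitions (σ.lkc t₂)})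
      (r : {t : T // t ∈ σ.futureTransitions (σ.lkc t₁)}) q,
      σ.Le (Sum.inr s.1) (Sum.inr t₂) → q ∈ (σ.glue t₁ t₂).pre (Sum.inl s) →
      q ∉ (σ.glue t₁ t₂).pre (Sum.inr r) := by
    rintro s r q hs ⟨p, hp, hq⟩ ⟨p', -, hq'⟩
    rcases q with q | q
    · obtain rfl : q.1 = p := hq
      exact Net.not_lkc_le hq'.2.1 ((Net.le_of_mem_pre hp).trans hs)
    · exact hkept s.1 p q hp hs hq
  constructor
  · rintro (s | s) hs q ⟨p, hp, hpq⟩ (r | r) hr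
    · obtain ⟨q, rfl, hqr⟩ := h.mem_post_inl_iff.1 hr
      obtain rfl : q.1 = p := hpq
      exact ((Net.le_of_mem_post hqr).trans (Net.le_of_mem_pre hp)).trans hs
    · obtain ⟨q, rfl, hqr⟩ := h.mem_post_inr_iff.1 hr
      exact absurd hpq (hkept s.1 p q hp hs)
    · obtain ⟨q, rfl, hqr⟩ := h.mem_post_inl_iff.1 hr
      exact hpq.2.1.2 r.1 hqr
    · obtain ⟨q, rfl, hqr⟩ := h.mem_post_inr_iff.1 hr
      obtain rfl : q.1 = p := hpq
      exact ((Net.le_of_mem_post hqr).trans (Net.le_of_mem_pre hp)).trans hs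
  · rintro (s | s) hs (r | r) hr q hqs hqr
    · obtain ⟨p, hp, hpq⟩ := hqs
      obtain ⟨p', hp', hpq'⟩ := hqr
      obtain rfl := rename_left_unique p p' q hpq hpq'
      exact congrArg Sum.inl (Subtype.ext
        ((hN.isConfig_le (Sum.inr t₂)).eq_of_mem_pre _ hs _ hr p hp hp'))
    · exact absurd hqr (hmixed s r q hs hqs)
    · exact absurd hqs (hmixed r s q hr hqr)
    · obtain ⟨p, hp, hpq⟩ := hqs
      obtain ⟨p', hp', hpq'⟩ := hqr
      obtain rfl := h.copy_left_unique p p' q hpq hpq'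
      exact congrArg Sum.inr (Subtype.ext
        ((hN.isConfig_le (Sum.inr t₀)).eq_of_mem_pre _ hs _ hr p hp hp'))

theorem mem_init_iff {q : σ.GluePlace (σ.lkc t₁) (σ.lkc t₂)} :
    q ∈ (σ.glue t₁ t₂).init ↔ ∃ q', q = Sum.inl q' ∧ q'.1 ∈ σ.init := by
  constructor
  · rintro ⟨p, hp, hq⟩
    exact ⟨_, (h.rename_init_iff hp).1 hq, hp⟩
  · rintro ⟨q', rfl, hq⟩
    exact ⟨_, hq, rfl⟩

theorem glue_init_eq :
    (σ.glue t₁ t₂).init = {q | {s | q ∈ (σ.glue t₁ t₂).post s} = ∅} := by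
  have hN := h.isOccurrenceNet
  have hinit : ∀ p, p ∈ σ.init ↔ ∀ s, p ∉ σ.post s := fun p => by
    rw [hN.init_eq, Set.mem_ofPred_eq, Set.eq_empty_iff_forall_notMem]
    rfl
  ext q
  rw [h.mem_init_iff, Set.mem_ofPred_eq, Set.eq_empty_iff_forall_notMem]
  constructor
  · rintro ⟨q, rfl, hq⟩ (s | s) hs
    · obtain ⟨q', hqq, hq'⟩ := h.mem_post_inl_iff.1 hs
      cases hqq
      exact (hinit _).1 hq _ hq'
    · obtain ⟨q', hqq, -⟩ := h.mem_post_inr_iff.1 hs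
      cases hqq
  · intro hq
    rcases q with q | q
    · refine ⟨q, rfl, (hinit _).2 fun s hs => ?_⟩
      by_cases hsf : s ∈ σ.futureTransitions (σ.lkc t₂)
      · have hsa := h.symm.mem_futureTransitions.1 hsf
        exact q.2 ⟨h.symm.mem_futurePlaces.2 (hsa.of_mem_post hN hs), hsa.notMem_lkc hs⟩
      · exact hq (Sum.inl ⟨s, hsf⟩) (h.mem_post_inl_iff.2 ⟨q, rfl, hs⟩)
    · have hqa := h.mem_futurePlaces.1 q.2.1
      obtain ⟨s, hs⟩ := hqa.exists_producer q.2.2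
      exact absurd (h.mem_post_inr_iff.2 ⟨q, rfl, hs⟩)
        (hq (Sum.inr ⟨s, h.mem_futureTransitions.2 (hqa.producer hN hs q.2.2)⟩))

theorem glue_isBranchingProc (hN₀ : N₀.IsPetriNet) : (σ.glue t₁ t₂).IsBranchingProc N₀ where
  isOccurrenceNet := by
    have hom := h.isHom
    have hprod : ∀ q, {s | q ∈ (σ.glue t₁ t₂).post s}.Subsingleton :=
      fun q s hs s' hs' => h.producer_unique hs hs'
    have hpre : ∀ s, ((σ.glue t₁ t₂).pre s).Finite := fun s =>
      .of_finite_image ((hom.pre_bijOn s).image_eq ▸ hN₀.pre_finite _) (hom.pre_bijOn s).injOn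
    exact
      { pre_finite := hpre
        pre_nonempty := fun s => Set.image_nonempty.1
          ((hom.pre_bijOn s).image_eq ▸ hN₀.pre_nonempty _)
        post_finite := fun s => .of_finite_image
          ((hom.post_bijOn s).image_eq ▸ hN₀.post_finite _) (hom.post_bijOn s).injOn
        acyclic := Net.acyclic_of_measure (measure σ t₁ t₂) h.measure_lt
        finitely_preceded := Net.finitely_preceded_of_measure (measure σ t₁ t₂) h.measure_lt
          hpre hprod
        pre_place_subsingleton := hprod
        no_self_conflict := by
          rintro (s | s)
          · exact (h.isPreconfig_kept s.1).not_conflict (Net.Le.refl (N := σ.toNet) _)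
              (Net.Le.refl (N := σ.toNet) _)
          · exact (h.isPreconfig_copy s.1).not_conflict (Net.Le.refl (N := σ.toNet) _)
              (Net.Le.refl (N := σ.toNet) _)
        init_eq := h.glue_init_eq }
  isHom := h.isHom
  eq_of_pre_eq := h.eq_of_pre_eq

/-! ### Reachable markings of the glued process -/

/-- A copied transition enabled at a marking of the part where `t₂` has not fired belongs to the
common part of the two futures. -/
theorem pre_subset_of_copy_of_rename {X : Set T} (hX : σ.IsPreconfig X) (ht : t₂ ∉ X) {s : T}
    (hs : s ∈ σ.futureTransitions (σ.lkc t₁))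
    (hsub : relImage (σ.Copy (σ.lkc t₁) (σ.lkc t₂)) (σ.pre s) ⊆
      relImage (σ.Rename (σ.lkc t₁) (σ.lkc t₂)) (σ.cut X)) :
    σ.pre s ⊆ σ.cut X ∧ ¬ σ.Le (Sum.inr t₁) (Sum.inr s) := by
  have hsa := h.mem_futureTransitions.1 hs
  have key : ∀ p ∈ σ.pre s, p ∈ σ.cut X ∧ ¬ σ.Le (Sum.inr t₁) (Sum.inl p) := by
    intro p hp
    obtain ⟨q, hq⟩ := h.copy_total_pre hs hp
    obtain ⟨p', hp', hq'⟩ := hsub ⟨p, hp, hq⟩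
    obtain ⟨rfl, hn⟩ := h.eq_of_copy_of_rename hq hq' fun hle => ht (hX.mem_of_le_cut hle hp')
    exact ⟨hp', hn⟩
  refine ⟨fun p hp => (key p hp).1, fun hle => ?_⟩
  rcases Net.le_inr_cases hle with heq | ⟨p, hp, hle⟩
  · exact Net.not_after_self t₁ (heq ▸ hsa)
  · exact (key p hp).2 hle

theorem pre_copy_eq {s : T} (hs : s ∈ σ.futureTransitions (σ.lkc t₁))
    (hn : ¬ σ.Le (Sum.inr t₁) (Sum.inr s)) :
    relImage (σ.Copy (σ.lkc t₁) (σ.lkc t₂)) (σ.pre s) =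
      relImage (σ.Rename (σ.lkc t₁) (σ.lkc t₂)) (σ.pre s) :=
  relImage_congr fun _ hp => h.copy_iff_rename ((h.mem_futureTransitions.1 hs).of_mem_pre hp)
    fun hle => hn (hle.trans (Net.le_of_mem_pre hp))

theorem post_copy_eq {s : T} (hs : s ∈ σ.futureTransitions (σ.lkc t₁))
    (hn : ¬ σ.Le (Sum.inr t₁) (Sum.inr s)) :
    relImage (σ.Copy (σ.lkc t₁) (σ.lkc t₂)) (σ.post s) =
      relImage (σ.Rename (σ.lkc t₁) (σ.lkc t₂)) (σ.post s) :=
  relImage_congr fun _ hp => h.copy_iff_rename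
    ((h.mem_futureTransitions.1 hs).of_mem_post h.isOccurrenceNet hp)
    fun hle => hn (h.isOccurrenceNet.le_producer hle hp)

/-- As long as `t₂` has not fired, the glued process behaves like `σ`. -/
theorem isMatch_rename {X : Set T} (hX : σ.IsPreconfig X) (ht : t₂ ∉ X) :
    IsMatch σ (σ.glue t₁ t₂) (σ.Rename (σ.lkc t₁) (σ.lkc t₂)) (σ.cut X) where
  total p hp := h.rename_total fun _ hle => ht (hX.mem_of_le_cut hle hp)
  left_unique := rename_left_unique
  label := rename_label
  consumer := by
    rintro p hp q (s | s) hpq ⟨p', hp', hq⟩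
    · obtain rfl := rename_left_unique p p' q hpq hq
      exact ⟨s.1, rfl, hp'⟩
    · obtain ⟨rfl, -⟩ := h.eq_of_copy_of_rename hq hpq fun hle => ht (hX.mem_of_le_cut hle hp)
      exact ⟨s.1, rfl, hp'⟩
  lower := by
    rintro (s | s) hs
    · exact ⟨s.1, rfl, subset_of_relImage_subset rename_left_unique
        (fun p hp => h.rename_total_pre s.2 hp) hs, rfl⟩
    · obtain ⟨hsub, hn⟩ := h.pre_subset_of_copy_of_rename hX ht s.2 hs
      exact ⟨s.1, rfl, hsub, h.pre_copy_eq s.2 hn⟩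
  lift s hs := by
    by_cases hsf : s ∈ σ.futureTransitions (σ.lkc t₂)
    · have hsa := h.symm.mem_futureTransitions.1 hsf
      have hn : ¬ σ.Le (Sum.inr t₂) (Sum.inr s) := fun hle => by
        rcases Net.le_inr_cases hle with heq | ⟨p, hp, hle⟩
        · exact Net.not_after_self t₂ (heq ▸ hsa)
        · exact ht (hX.mem_of_le_cut hle (hs hp))
      have hs₁ := h.symm.common hsa hn
      have hsf₁ := h.mem_futureTransitions.2 hs₁.1
      exact ⟨Sum.inr ⟨s, hsf₁⟩, rfl, h.pre_copy_eq hsf₁ hs₁.2⟩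
    · exact ⟨Sum.inl ⟨s, hsf⟩, rfl, rfl⟩

/-- Once `t₂` has fired, the glued process behaves like `σ` after `t₁`. -/
theorem isMatch_copy {X : Set T} (hX : σ.IsPreconfig X) (ht : t₁ ∈ X) :
    IsMatch σ (σ.glue t₁ t₂) (σ.Copy (σ.lkc t₁) (σ.lkc t₂)) (σ.cut X) where
  total p hp := h.copy_total (Net.after_of_mem_cut hX ht hp)
  left_unique := h.copy_left_unique
  label := copy_label
  consumer := by
    rintro p hp q (s | s) hpq ⟨p', hp', hq⟩
    · obtain ⟨rfl, -⟩ := h.eq_of_copy_of_rename hpq hq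
        (h.isOccurrenceNet.not_le_of_mem_pre_of_not_after (h.after_kept s.2) hp')
      exact ⟨s.1, rfl, hp'⟩
    · obtain rfl := h.copy_left_unique p p' q hpq hq
      exact ⟨s.1, rfl, hp'⟩
  lower := by
    rintro (s | s) hs
    · exact absurd hs (h.not_relImage_subset s.2)
    · exact ⟨s.1, rfl, subset_of_relImage_subset h.copy_left_unique
        (fun p hp => h.copy_total_pre s.2 hp) hs, rfl⟩
  lift s hs := by
    have hsa : σ.After t₁ (Sum.inr s) := h.isOccurrenceNet.after_of_forall_mem_pre
      fun p hp => Net.after_of_mem_cut hX ht (hs hp)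
    exact ⟨Sum.inr ⟨s, h.mem_futureTransitions.2 hsa⟩, rfl, rfl⟩

/-- Labels being injective on the two cuts, which agree outside the postsets, the copies of the
places produced by `t₁` are the places produced by `t₂`. -/
theorem relImage_rename_post :
    relImage (σ.Rename (σ.lkc t₁) (σ.lkc t₂)) (σ.post t₂) =
      relImage (σ.Copy (σ.lkc t₁) (σ.lkc t₂)) (σ.post t₁) := by
  have hN := h.isOccurrenceNet
  have key : ∀ {t t'}, σ.IsGluePair N₀ t t' → ∀ c ∈ σ.lkc t, ∀ c' ∈ σ.post t',
      σ.πP c = σ.πP c' → c ∈ σ.post t := by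
    intro t t' h c hc c' hc' hl
    by_contra hcp
    have hc'₂ := hN.post_subset_lkc t' hc'
    obtain rfl := h.mate_eq_of_not_le hc hc'₂ hl.symm (hN.not_le_of_mem_lkc_sdiff hc hcp)
    exact h.symm.not_le_of_mem_inter hc'₂ hc (Net.le_of_mem_post hc')
  ext q
  constructor
  · rintro ⟨p, hp, hq⟩
    have hp₂ := hN.post_subset_lkc t₂ hp
    rcases q with q | q
    · obtain rfl : q.1 = p := hq
      obtain ⟨c, hc, hl⟩ := h.symm.exists_mate hp₂
      exact ⟨c, key h c hc _ hp hl, hc, hp₂, hl.symm⟩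
    · exact absurd hp₂ hq.2.1.2
  · rintro ⟨p, hp, hq⟩
    have hp₁ := hN.post_subset_lkc t₁ hp
    rcases q with q | q
    · exact ⟨q.1, key h.symm q.1 hq.2.1 p hp hq.2.2, rfl⟩
    · obtain rfl : q.1 = p := hq
      exact absurd hp₁ q.2.2

/-- When `t₂` fires, the marking of the glued process is at the same time the copy of a marking
reachable after `t₁`: the transitions `X` fired before `t₂` but not needed for it could have fired
after `t₁` as well. -/
theorem exists_config_relImage_copy {X : Set T} (hX : σ.IsConfig X)
    (ht : σ.pre t₂ ⊆ σ.cut X) :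
    ∃ X', σ.IsConfig X' ∧ t₁ ∈ X' ∧
      relImage (σ.Rename (σ.lkc t₁) (σ.lkc t₂)) (σ.cut (insert t₂ X)) =
        relImage (σ.Copy (σ.lkc t₁) (σ.lkc t₂)) (σ.cut X') := by
  have hN := h.isOccurrenceNet
  have htX : t₂ ∉ X := hN.notMem_of_pre_subset_cut ht
  have hX₂ := hX.insert ht
  let Y : Set T := {s ∈ X | σ.After t₂ (Sum.inr s)}
  have hY₂ : ∀ s ∈ Y, σ.After t₂ (Sum.inr s) ∧ ¬ σ.Le (Sum.inr t₂) (Sum.inr s) :=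
    fun s hs => ⟨hs.2, fun hle => htX (hX.mem_of_le hle hs.1)⟩
  have hY₁ : ∀ s ∈ Y, σ.After t₁ (Sum.inr s) ∧ ¬ σ.Le (Sum.inr t₁) (Sum.inr s) :=
    fun s hs => h.symm.common (hY₂ s hs).1 (hY₂ s hs).2
  have hXY : insert t₂ X = {s | σ.Le (Sum.inr s) (Sum.inr t₂)} ∪ Y := by
    ext s
    constructor
    · rintro (rfl | hs)
      · exact .inl (Net.Le.refl _)
      · by_cases hle : σ.Le (Sum.inr s) (Sum.inr t₂)
        · exact .inl hle
        · exact .inr ⟨hs, hle, hX₂.not_conflict (.inr hs) (.inl rfl)⟩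
    · rintro (hs | hs)
      · exact hX₂.mem_of_le hs (.inl rfl)
      · exact .inr hs.1
  have hX₁ : σ.IsConfig ({s | σ.Le (Sum.inr s) (Sum.inr t₁)} ∪ Y) :=
    hN.isConfig_union (hX.finite.subset fun s hs => hs.1) hY₁
      (fun s hs p hp r hr hra => ⟨hX.closed s hs.1 p hp r hr, (h.common hra.1 hra.2).1⟩)
      fun s hs r hr => hX.eq_of_mem_pre s hs.1 r hr.1
  refine ⟨_, hX₁, .inl (Net.Le.refl _), ?_⟩
  have hcommon : ∀ x, (σ.After t₁ x ∧ ¬ σ.Le (Sum.inr t₁) x) ↔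
      (σ.After t₂ x ∧ ¬ σ.Le (Sum.inr t₂) x) :=
    fun x => ⟨fun hx => h.common hx.1 hx.2, fun hx => h.symm.common hx.1 hx.2⟩
  rw [hXY] at hX₂ ⊢
  rw [← Set.sdiff_union_of_subset (hN.post_subset_cut_union fun s hs => (hY₂ s hs).2),
    ← Set.sdiff_union_of_subset (hN.post_subset_cut_union fun s hs => (hY₁ s hs).2),
    relImage_union, relImage_union, h.relImage_rename_post,
    hN.cut_union_sdiff_post hY₁ hX₁.toIsPreconfig, hN.cut_union_sdiff_post hY₂ hX₂.toIsPreconfig]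
  simp only [← hcommon]
  congr 1
  exact relImage_congr fun p hp q => (h.copy_iff_rename hp.1.1 hp.1.2 q).symm

/-- A reachable marking of the glued process is a renamed marking of `σ` before `t₂`, or a copy of
a marking of `σ` after `t₁`. -/
theorem exists_config_of_reachable {M : σ.GluePlace (σ.lkc t₁) (σ.lkc t₂) → ℕ}
    (hM : (σ.glue t₁ t₂).Reachable M) :
    (∃ X, σ.IsConfig X ∧ t₂ ∉ X ∧
      M = (relImage (σ.Rename (σ.lkc t₁) (σ.lkc t₂)) (σ.cut X)).indicator 1) ∨
    ∃ X, σ.IsConfig X ∧ t₁ ∈ X ∧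
      M = (relImage (σ.Copy (σ.lkc t₁) (σ.lkc t₂)) (σ.cut X)).indicator 1 := by
  have hN := h.isOccurrenceNet
  induction hM with
  | init => exact .inl ⟨∅, Net.isConfig_empty, id, by rw [hN.cut_empty]; rfl⟩
  | step M s' hM hs ih =>
    rcases ih with ⟨X, hX, ht, rfl⟩ | ⟨X, hX, ht, rfl⟩
    · rw [Net.enabled_indicator] at hs
      rcases s' with s | s
      · have hsub := subset_of_relImage_subset rename_left_unique
          (fun p hp => h.rename_total_pre s.2 hp) hs
        have hfire := fire_relImage (B' := σ.glue t₁ t₂) (t' := Sum.inl s) rename_left_unique hN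
          hX.toIsPreconfig hsub rfl rfl
        by_cases hst : s.1 = t₂
        · rw [hst] at hsub
          obtain ⟨X', hX', ht', heq⟩ := h.exists_config_relImage_copy hX hsub
          exact .inr ⟨X', hX', ht', by rw [hfire, hst, heq]⟩
        · refine .inl ⟨_, hX.insert hsub, ?_, hfire⟩
          rintro (heq | hmem)
          exacts [hst heq.symm, ht hmem]
      · obtain ⟨hsub, hn⟩ := h.pre_subset_of_copy_of_rename hX.toIsPreconfig ht s.2 hs
        refine .inl ⟨_, hX.insert hsub, ?_, fire_relImage (B' := σ.glue t₁ t₂) (t' := Sum.inr s)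
          rename_left_unique hN hX.toIsPreconfig hsub (h.pre_copy_eq s.2 hn)
          (h.post_copy_eq s.2 hn)⟩
        have hsa := (h.common (h.mem_futureTransitions.1 s.2) hn).1
        rintro (heq | hmem)
        · rw [← heq] at hsa
          exact Net.not_after_self t₂ hsa
        · exact ht hmem
    · rw [Net.enabled_indicator] at hs
      rcases s' with s | s
      · exact absurd hs (h.not_relImage_subset s.2)
      · have hsub := subset_of_relImage_subset h.copy_left_unique
          (fun p hp => h.copy_total_pre s.2 hp) hs
        exact .inr ⟨_, hX.insert hsub, .inr ht, fire_relImage (B' := σ.glue t₁ t₂)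
          (t' := Sum.inr s) h.copy_left_unique hN hX.toIsPreconfig hsub rfl rfl⟩

end IsGluePair

/-- Partial repetition cuts of a winning strategy are imitable, in one direction. -/
theorem IsWinning.isImitableBy {σ : LabelledNet P T P₀ T₀} {G : PetriGame P₀ T₀}
    (hσ : σ.IsWinning G) {t₁ t₂ : T} (hprc : σ.Prc t₁ t₂) :
    σ.IsImitableBy G (σ.lkc t₂) (σ.lkc t₁) := by
  have hB := hσ.isBranchingProc
  have hN := hB.isOccurrenceNet
  refine ⟨hN.isCut_lkc t₁, hN.isCut_lkc t₂, ?_⟩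
  by_cases heq : σ.lkc t₁ = σ.lkc t₂
  · rw [← heq]
    exact hσ.cutGlue_self (hB.injOn_lkc G.isSafe t₁)
  -- if one postset is empty, then the cuts are equal, since labels are injective on cuts
  have hpost : ∀ {t t'}, σ.Prc t t' → (σ.post t).Nonempty ∨ σ.lkc t = σ.lkc t' := by
    intro t t' hprc
    refine or_iff_not_imp_left.2 fun hne => ?_
    rw [Set.not_nonempty_iff_eq_empty] at hne
    have hA := hprc.2
    rw [hne, Set.sdiff_empty] at hA
    refine Set.Subset.antisymm (hA ▸ Set.sdiff_subset) fun c hc => ?_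
    obtain ⟨c', hc', hl⟩ : σ.πP c ∈ σ.lkm t := hprc.1 ▸ ⟨c, hc, rfl⟩
    have hc'₂ : c' ∈ σ.lkc t' := (hA ▸ hc' : c' ∈ σ.lkc t' \ σ.post t').1
    exact hB.injOn_lkc G.isSafe t' hc'₂ hc hl ▸ hc'
  have h : σ.IsGluePair G.toNet t₁ t₂ :=
    ⟨hB, G.isSafe, hprc, fun h => heq (h ▸ rfl), (hpost hprc).resolve_right heq,
      (hpost hprc.symm).resolve_right (Ne.symm heq)⟩
  refine hσ.of_isMatch (h.glue_isBranchingProc G.isPetriNet) fun M hM => ?_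
  rcases h.exists_config_of_reachable hM with ⟨X, hX, ht, rfl⟩ | ⟨X, hX, ht, rfl⟩
  · exact ⟨X, _, hX, h.isMatch_rename hX.toIsPreconfig ht, rfl⟩
  · exact ⟨X, _, hX, h.isMatch_copy hX.toIsPreconfig ht, rfl⟩

end LabelledNet

theorem mainTheorem4 {P₀ : Type u₀} {T₀ : Type v₀} [Finite P₀] [Finite T₀]
    (G : PetriGame P₀ T₀) {P : Type u} {T : Type v} (σ : LabelledNet P T P₀ T₀)
    (hσ : σ.IsWinning G) (t₁ t₂ : T) (hprc : σ.Prc t₁ t₂) :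
    σ.IsImitableBy G (σ.lkc t₂) (σ.lkc t₁) ∧ σ.IsImitableBy G (σ.lkc t₁) (σ.lkc t₂) :=
  ⟨hσ.isImitableBy hprc, hσ.isImitableBy hprc.symm⟩
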